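/- For $x,\xi\in\mathbb R^d$ let $T_xf(t)=f(t-x)$ and $M_\xi f(t)=e^{2\pi i t\cdot\xi}f(t)$, extended to tempered distributions in the usual way. A complex Banach space $E$ is called a *TMIB space* (translation-modulation invariant Banach space of distributions) on $\mathbb R^d$ if (I) $\mathcal S(\mathbb R^d)\subseteq E\subseteq\mathcal S'(\mathbb R^d)$, where both inclusions are continuous and have dense image; (II) $T_x(E)\subseteq E$ and $M_\xi(E)\subseteq E$ for all $x,\xi\in\mathbb R^d$; (III) there are $\tau,C>0$ such that $\|T_x\|_{\mathcal L(E)}\le C(1+|x|)^\tau$ and $\|M_{-\xi}\|_{\mathcal L(E)}\le C(1+|\xi|)^\tau$ for all $x,\xi\in\mathbb R^d$. Let $\mathcal L_c(E,E)$ be the space of continuous linear operators on $E$ with the topology of uniform convergence on compact subsets of $E$, and regard $E'\otimes E$ as a space of finite-rank operators via $(f\otimes e)(x)=f(x)\,e$. **Theorem.** Let $E$ be a TMIB space on $\mathbb R^d$. (a) There are $S_{n,m}\in E'\otimes E$ $(n,m\in\mathbb N)$ such that for every $m$ the limit $G_m=\lim_{n\to\infty}S_{n,m}$ exists in $\mathcal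 L_c(E,E)$, and $\lim_{m\to\infty}G_m=\operatorname{Id}$ in $\mathcal L_c(E,E)$. (b) $E$ has the weak sequential approximation property: there is a sequence in $E'\otimes E$ that converges to $\operatorname{Id}$ in $\mathcal L_c(E,E)$. (c) For every TMIB space $F$ on $\mathbb R^d$, the completed projective tensor product $E\hat\otimes_\pi F$ is a TMIB space on $\mathbb R^{2d}$. That is, there is a continuous linear map $E\hat\otimes_\pi F\to\mathcal S'(\mathbb R^{2d})$ that sends $e\otimes f$ to the tensor product of the distributions $e$ and $f$ (the distribution $w$ with $\langle w,\varphi\otimes\psi\rangle=\langle e,\varphi\rangle\langle f,\psi\rangle$ for all $\varphi,\psi\in\mathcal S(\mathbb R^d)$), and $E\hat\otimes_\pi F$ satisfies (I)-(III) on $\mathbb R^{2d}$ when it is regarded as a space of distributions through this map; in particular the map is injective. -/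

import Mathlib

open Filter Topology
open scoped SchwartzMap TensorProduct ContDiff InnerProductSpace CompactConvergenceCLM

noncomputable section

namespace TMIB

/-! ### Translation and modulation on tempered distributions -/

section Operators

variable {V : Type*} [NormedAddCommGroup V] [InnerProductSpace ℝ V]

/-- Translation of tempered distributions: `⟨T_x u, φ⟩ = ⟨u, φ(· + x)⟩`, which extends
`(T_x f)(t) = f(t - x)`. -/
def translate (x : V) : 𝓢'(V, ℂ) →L[ℂ] 𝓢'(V, ℂ) :=
  PointwiseConvergenceCLM.precomp ℂ (SchwartzMap.compSubConstCLM ℂ (-x))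

/-- The character `t ↦ e^{2πi t·ξ}`. -/
def character (ξ : V) (t : V) : ℂ :=
  Complex.exp (2 * Real.pi * Complex.I * (⟪ξ, t⟫_ℝ : ℝ))

/-- Modulation of tempered distributions: multiplication by `t ↦ e^{2πi t·ξ}`, i.e.
`⟨M_ξ u, φ⟩ = ⟨u, e^{2πi ξ·} φ⟩`. -/
def modulate (ξ : V) : 𝓢'(V, ℂ) →L[ℂ] 𝓢'(V, ℂ) :=
  TemperedDistribution.smulLeftCLM ℂ (character ξ)

/-- Characters have temperate growth, so that `modulate` really is the multiplication. -/
theorem character_hasTemperateGrowth (ξ : V) : (character ξ).HasTemperateGrowth := by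
  have h1 : Function.HasTemperateGrowth
      (fun s : ℝ => Complex.exp (2 * Real.pi * Complex.I * (s : ℂ))) := by
    refine ⟨(contDiff_const.mul Complex.ofRealCLM.contDiff).cexp, fun n => ⟨0, (2 * Real.pi) ^ n, fun s => ?_⟩⟩
    have key : ∀ n : ℕ, iteratedDeriv n
        (fun s : ℝ => Complex.exp (2 * Real.pi * Complex.I * (s : ℂ))) =
        fun s : ℝ => (2 * Real.pi * Complex.I) ^ n *
          Complex.exp (2 * Real.pi * Complex.I * (s : ℂ)) := by
      intro n
      induction n with
      | zero => simp
      | succ n ih =>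
        rw [iteratedDeriv_succ, ih]
        funext s
        have h0 : HasDerivAt (fun s : ℝ => 2 * Real.pi * Complex.I * (s : ℂ))
            (2 * Real.pi * Complex.I) s := by
          simpa using (Complex.ofRealCLM.hasDerivAt (x := s)).const_mul
            (2 * Real.pi * Complex.I)
        rw [(h0.cexp.const_mul _).deriv]
        ring
    rw [norm_iteratedFDeriv_eq_norm_iteratedDeriv, key]
    have : ‖Complex.exp (2 * Real.pi * Complex.I * (s : ℂ))‖ = 1 := by
      have := Complex.norm_exp_ofReal_mul_I (2 * Real.pi * s)
      rw [← this]
      congr 2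
      push_cast
      ring
    simp [this, abs_of_pos Real.pi_pos]
  exact h1.comp (g := fun s : ℝ => Complex.exp (2 * Real.pi * Complex.I * (s : ℂ)))
    (f := fun t : V => ⟪ξ, t⟫_ℝ) (by fun_prop)

theorem translate_apply (x : V) (u : 𝓢'(V, ℂ)) (φ : 𝓢(V, ℂ)) :
    translate x u φ = u (SchwartzMap.compSubConstCLM ℂ (-x) φ) := rfl

theorem modulate_apply (ξ : V) (u : 𝓢'(V, ℂ)) (φ : 𝓢(V, ℂ)) :
    modulate ξ u φ = u (SchwartzMap.smulLeftCLM ℂ (character ξ) φ) := rfl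

end Operators

/-! ### Translation-modulation invariant Banach spaces of distributions -/

/-- `IsTMIB J` says that the normed space `E`, regarded as a space of tempered distributions on
`ℝ^ι` through the inclusion `J : E → 𝓢'(ℝ^ι)`, is a TMIB space. -/
structure IsTMIB {ι : Type*} [Fintype ι] {E : Type*} [NormedAddCommGroup E] [NormedSpace ℂ E]
    (J : E →L[ℂ] 𝓢'(EuclideanSpace ℝ ι, ℂ)) : Prop where
  /-- `E` is a Banach space. -/
  complete : CompleteSpace E
  /-- `E ↪ 𝓢'` is an inclusion (its continuity is built into the type of `J`). -/
  injective : Function.Injective J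
  /-- `E` is dense in `𝓢'`. -/
  dense : DenseRange J
  /-- `𝓢` is continuously and densely included in `E`. -/
  schwartz : ∃ j : 𝓢(EuclideanSpace ℝ ι, ℂ) →L[ℂ] E,
    (∀ φ, J (j φ) = SchwartzMap.toTemperedDistributionCLM (EuclideanSpace ℝ ι) ℂ
      MeasureTheory.volume φ) ∧ DenseRange j
  /-- `T_x E ⊆ E`. -/
  translate_mem : ∀ (x : EuclideanSpace ℝ ι) (e : E), translate x (J e) ∈ Set.range J
  /-- `M_ξ E ⊆ E`. -/
  modulate_mem : ∀ (ξ : EuclideanSpace ℝ ι) (e : E), modulate ξ (J e) ∈ Set.range J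
  /-- `‖T_x‖ ≤ C (1 + |x|)^τ` and `‖M_{-ξ}‖ ≤ C (1 + |ξ|)^τ` as operators on `E`; here `e'`
  is the element `T_x e`, respectively `M_{-ξ} e`, of `E`. -/
  growth : ∃ τ > (0 : ℝ), ∃ C > (0 : ℝ),
    (∀ (x : EuclideanSpace ℝ ι) (e e' : E), J e' = translate x (J e) →
      ‖e'‖ ≤ C * (1 + ‖x‖) ^ τ * ‖e‖) ∧
    (∀ (ξ : EuclideanSpace ℝ ι) (e e' : E), J e' = modulate (-ξ) (J e) →
      ‖e'‖ ≤ C * (1 + ‖ξ‖) ^ τ * ‖e‖)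

/-! ### Finite rank operators and the approximation property -/

section Approximation

variable (E : Type*) [NormedAddCommGroup E] [NormedSpace ℂ E]

/-- The canonical map `E' ⊗ E → 𝓛_c(E, E)`, `f ⊗ e ↦ (x ↦ f(x) e)`. -/
def tensorToOperator : (E →L[ℂ] ℂ) ⊗[ℂ] E →ₗ[ℂ] (E →L_c[ℂ] E) :=
  (ContinuousLinearMap.toUniformConvergenceCLM (RingHom.id ℂ) E
      {S : Set E | IsCompact S}).toLinearMap ∘ₗ
    TensorProduct.lift (LinearMap.mk₂ ℂ
      (fun (f : E →L[ℂ] ℂ) (e : E) => f.smulRight e)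
      (fun f g e => by ext x; simp [add_smul])
      (fun c f e => by ext x; simp [mul_smul])
      (fun f e e' => by ext x; simp [smul_add])
      (fun c f e => by ext x; simp [smul_comm c]))

theorem tensorToOperator_tmul (f : E →L[ℂ] ℂ) (e x : E) :
    tensorToOperator E (f ⊗ₜ e) x = f x • e := rfl

/-- The identity as an element of `𝓛_c(E, E)`. -/
def idOperator : E →L_c[ℂ] E :=
  ContinuousLinearMap.toUniformConvergenceCLM (RingHom.id ℂ) E {S : Set E | IsCompact S}
    (ContinuousLinearMap.id ℂ E)

/-- The weak sequential approximation property of a Banach space: the identity is the limit in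
`𝓛_c(E, E)` of a sequence of operators from `E' ⊗ E`. -/
def HasWeakSequentialApproximationProperty : Prop :=
  idOperator E ∈ seqClosure (Set.range (tensorToOperator E))

end Approximation

/-! ### The completed projective tensor product -/

section Projective

variable (E F : Type*) [NormedAddCommGroup E] [NormedSpace ℂ E]
  [NormedAddCommGroup F] [NormedSpace ℂ F]

/-- A copy of the algebraic tensor product `E ⊗ F`, to carry the projective norm. -/
def ProjTensor : Type _ := E ⊗[ℂ] F

instance : AddCommGroup (ProjTensor E F) := inferInstanceAs (AddCommGroup (E ⊗[ℂ] F))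

instance : Module ℂ (ProjTensor E F) := inferInstanceAs (Module ℂ (E ⊗[ℂ] F))

variable {E F}

/-- The elementary tensor `e ⊗ f` in `E ⊗_π F`. -/
def ProjTensor.tmul (e : E) (f : F) : ProjTensor E F := (e ⊗ₜ[ℂ] f : E ⊗[ℂ] F)

/-- The element `∑ e_i ⊗ f_i` represented by a finite list of pairs. -/
def ProjTensor.ofList (l : List (E × F)) : ProjTensor E F :=
  (l.map fun p => ProjTensor.tmul p.1 p.2).sum

/-- The cost `∑ ‖e_i‖ ‖f_i‖` of a finite list of pairs. -/
def ProjTensor.cost {E F : Type*} [NormedAddCommGroup E] [NormedAddCommGroup F]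
    (l : List (E × F)) : ℝ := (l.map fun p => ‖p.1‖ * ‖p.2‖).sum

theorem ProjTensor.cost_nonneg {E F : Type*} [NormedAddCommGroup E] [NormedAddCommGroup F]
    (l : List (E × F)) : 0 ≤ ProjTensor.cost l := by
  refine List.sum_nonneg fun a ha => ?_
  obtain ⟨p, -, rfl⟩ := List.mem_map.1 ha
  positivity

theorem ProjTensor.exists_ofList (u : ProjTensor E F) : ∃ l, ProjTensor.ofList l = u := by
  refine TensorProduct.induction_on (motive := fun u => ∃ l, ProjTensor.ofList l = u) u
    ⟨[], rfl⟩ (fun e f => ⟨[(e, f)], by simp [ofList]; rfl⟩) ?_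
  rintro _ _ ⟨l, rfl⟩ ⟨l', rfl⟩
  exact ⟨l ++ l', by simp [ofList]; rfl⟩

instance (u : ProjTensor E F) : Nonempty {l : List (E × F) // ProjTensor.ofList l = u} :=
  let ⟨l, hl⟩ := ProjTensor.exists_ofList u
  ⟨⟨l, hl⟩⟩

/-- The projective norm: the infimum of `∑ ‖e_i‖ ‖f_i‖` over all representations
`u = ∑ e_i ⊗ f_i`. -/
instance : Norm (ProjTensor E F) :=
  ⟨fun u => ⨅ l : {l : List (E × F) // ProjTensor.ofList l = u}, ProjTensor.cost l.1⟩

theorem ProjTensor.norm_def (u : ProjTensor E F) :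
    ‖u‖ = ⨅ l : {l : List (E × F) // ProjTensor.ofList l = u}, ProjTensor.cost l.1 := rfl

theorem ProjTensor.norm_ofList_le (l : List (E × F)) : ‖ofList l‖ ≤ cost l :=
  ciInf_le (f := fun l' : {l' : List (E × F) // ofList l' = ofList l} => cost l'.1)
    ⟨0, by rintro _ ⟨l', rfl⟩; exact cost_nonneg _⟩ ⟨l, rfl⟩

theorem ProjTensor.norm_add_le' (u v : ProjTensor E F) : ‖u + v‖ ≤ ‖u‖ + ‖v‖ := by
  refine le_ciInf_add_ciInf fun l l' => ?_
  have h := norm_ofList_le (l.1 ++ l'.1)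
  have e1 : ofList (l.1 ++ l'.1) = u + v := by
    have h1 := l.2
    have h2 := l'.2
    simp only [ofList, List.map_append, List.sum_append] at h1 h2 ⊢
    rw [h1, h2]
  have e2 : cost (l.1 ++ l'.1) = cost l.1 + cost l'.1 := by simp [cost]
  rwa [e1, e2] at h

theorem ProjTensor.norm_smul_le' (c : ℂ) (u : ProjTensor E F) : ‖c • u‖ ≤ ‖c‖ * ‖u‖ := by
  rw [norm_def u, Real.mul_iInf_of_nonneg (norm_nonneg _)]
  refine le_ciInf fun l => ?_
  have h := norm_ofList_le (l.1.map fun p => (c • p.1, p.2))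
  have e1 : ofList (l.1.map fun p => (c • p.1, p.2)) = c • u := by
    refine Eq.trans ?_ (congrArg (c • ·) l.2)
    simp only [ofList, List.map_map, List.smul_sum]
    rfl
  have e2 : cost (l.1.map fun p => (c • p.1, p.2)) = ‖c‖ * cost l.1 := by
    simp [cost, Function.comp_def, norm_smul, mul_assoc, List.sum_map_mul_left]
  rwa [e1, e2] at h

theorem ProjTensor.norm_zero' : ‖(0 : ProjTensor E F)‖ = 0 :=
  le_antisymm (by simpa [ofList, cost] using norm_ofList_le ([] : List (E × F)))
    (le_ciInf fun l => cost_nonneg l.1)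

instance : SeminormedAddCommGroup (ProjTensor E F) :=
  AddGroupSeminorm.toSeminormedAddCommGroup
    (Seminorm.ofSMulLE (𝕜 := ℂ) norm ProjTensor.norm_zero' ProjTensor.norm_add_le'
      ProjTensor.norm_smul_le').toAddGroupSeminorm

instance : NormedSpace ℂ (ProjTensor E F) := ⟨ProjTensor.norm_smul_le'⟩

variable (E F) in
/-- The completed projective tensor product `E ⊗̂_π F`. -/
abbrev CompletedProjTensor : Type _ := UniformSpace.Completion (ProjTensor E F)

/-- The elementary tensor `e ⊗ f` in `E ⊗̂_π F`. -/
def ctmul (e : E) (f : F) : CompletedProjTensor E F :=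
  ((ProjTensor.tmul e f : ProjTensor E F) : CompletedProjTensor E F)

end Projective

/-! ### Tensor products of Schwartz functions and of tempered distributions -/

section Tensor

variable {ι κ : Type*} [Fintype ι] [Fintype κ]

/-- The projection `ℝ^ι × ℝ^κ = ℝ^(ι ⊕ κ) → ℝ^ι`. -/
def projLeft : EuclideanSpace ℝ (ι ⊕ κ) →L[ℝ] EuclideanSpace ℝ ι :=
  LinearMap.toContinuousLinearMap
    { toFun := fun z => WithLp.toLp 2 fun i => z (Sum.inl i)
      map_add' := fun _ _ => rfl
      map_smul' := fun _ _ => rfl }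

/-- The projection `ℝ^ι × ℝ^κ = ℝ^(ι ⊕ κ) → ℝ^κ`. -/
def projRight : EuclideanSpace ℝ (ι ⊕ κ) →L[ℝ] EuclideanSpace ℝ κ :=
  LinearMap.toContinuousLinearMap
    { toFun := fun z => WithLp.toLp 2 fun i => z (Sum.inr i)
      map_add' := fun _ _ => rfl
      map_smul' := fun _ _ => rfl }

theorem projLeft_apply (z : EuclideanSpace ℝ (ι ⊕ κ)) (i : ι) :
    projLeft z i = z (Sum.inl i) := rfl

theorem projRight_apply (z : EuclideanSpace ℝ (ι ⊕ κ)) (i : κ) :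
    projRight z i = z (Sum.inr i) := rfl

theorem norm_le_projLeft_add_projRight (z : EuclideanSpace ℝ (ι ⊕ κ)) :
    ‖z‖ ≤ ‖projLeft z‖ + ‖projRight z‖ := by
  have h : ‖z‖ ^ 2 = ‖projLeft z‖ ^ 2 + ‖projRight z‖ ^ 2 := by
    simp [EuclideanSpace.norm_sq_eq, projLeft_apply, projRight_apply]
  refine (sq_le_sq₀ (norm_nonneg z) (by positivity)).1 ?_
  nlinarith [mul_nonneg (norm_nonneg (projLeft z)) (norm_nonneg (projRight z))]

theorem contDiff_comp_clm {V W : Type*} [NormedAddCommGroup V] [NormedSpace ℝ V]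
    [NormedAddCommGroup W] [NormedSpace ℝ W] (p : V →L[ℝ] W) (φ : 𝓢(W, ℂ)) :
    ContDiff ℝ ∞ fun z => φ (p z) :=
  ContDiff.comp (g := φ) (f := p) (φ.smooth ⊤) p.contDiff

theorem norm_iteratedFDeriv_comp_clm_le {V W : Type*} [NormedAddCommGroup V] [NormedSpace ℝ V]
    [NormedAddCommGroup W] [NormedSpace ℝ W] (p : V →L[ℝ] W) (φ : 𝓢(W, ℂ)) (k i : ℕ) :
    ∃ C : ℝ, 0 ≤ C ∧ ∀ z, ‖p z‖ ^ k * ‖iteratedFDeriv ℝ i (fun z => φ (p z)) z‖ ≤ C := by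
  obtain ⟨C, hC0, hC⟩ := φ.decay k i
  refine ⟨‖p‖ ^ i * C, by positivity, fun z => ?_⟩
  have h1 : iteratedFDeriv ℝ i (fun z => φ (p z)) z =
      (iteratedFDeriv ℝ i φ (p z)).compContinuousLinearMap fun _ => p :=
    p.iteratedFDeriv_comp_right (φ.smooth i) z le_rfl
  have h2 := (iteratedFDeriv ℝ i φ (p z)).norm_compContinuousLinearMap_le fun _ => p
  rw [Finset.prod_const, Finset.card_univ, Fintype.card_fin] at h2
  rw [h1]
  calc _ ≤ ‖p z‖ ^ k * (‖iteratedFDeriv ℝ i φ (p z)‖ * ‖p‖ ^ i) := by gcongr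
    _ = ‖p‖ ^ i * (‖p z‖ ^ k * ‖iteratedFDeriv ℝ i φ (p z)‖) := by ring
    _ ≤ _ := by gcongr; exact hC _

theorem schwartzTensor_decay (φ : 𝓢(EuclideanSpace ℝ ι, ℂ)) (ψ : 𝓢(EuclideanSpace ℝ κ, ℂ))
    (k n : ℕ) : ∃ C : ℝ, ∀ z : EuclideanSpace ℝ (ι ⊕ κ),
      ‖z‖ ^ k * ‖iteratedFDeriv ℝ n (fun z => φ (projLeft z) * ψ (projRight z)) z‖ ≤ C := by
  choose A hA0 hA using norm_iteratedFDeriv_comp_clm_le (projLeft (ι := ι) (κ := κ)) φ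
  choose B hB0 hB using norm_iteratedFDeriv_comp_clm_le (projRight (ι := ι) (κ := κ)) ψ
  refine ⟨∑ i ∈ Finset.range (n + 1), (n.choose i : ℝ) *
    (2 ^ (k - 1) * (A k i * B 0 (n - i) + A 0 i * B k (n - i))), fun z => ?_⟩
  have hs1 : ContDiff ℝ ∞ fun z : EuclideanSpace ℝ (ι ⊕ κ) => φ (projLeft z) :=
    contDiff_comp_clm _ φ
  have hs2 : ContDiff ℝ ∞ fun z : EuclideanSpace ℝ (ι ⊕ κ) => ψ (projRight z) :=
    contDiff_comp_clm _ ψ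
  have h := norm_iteratedFDeriv_mul_le (𝕜 := ℝ) hs1 hs2 z (n := n)
    (by exact_mod_cast (le_top : (n : ℕ∞) ≤ ⊤))
  have hz : ‖z‖ ^ k ≤ 2 ^ (k - 1) * (‖projLeft z‖ ^ k + ‖projRight z‖ ^ k) :=
    (pow_le_pow_left₀ (norm_nonneg z) (norm_le_projLeft_add_projRight z) k).trans
      (add_pow_le (norm_nonneg _) (norm_nonneg _) k)
  refine (mul_le_mul_of_nonneg_left h (by positivity)).trans ?_
  rw [Finset.mul_sum]
  refine Finset.sum_le_sum fun i _ => ?_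
  set a := ‖iteratedFDeriv ℝ i (fun z : EuclideanSpace ℝ (ι ⊕ κ) => φ (projLeft z)) z‖
  set b := ‖iteratedFDeriv ℝ (n - i)
    (fun z : EuclideanSpace ℝ (ι ⊕ κ) => ψ (projRight z)) z‖
  have ha : a ≤ A 0 i := by simpa using hA 0 i z
  have hb : b ≤ B 0 (n - i) := by simpa using hB 0 (n - i) z
  calc ‖z‖ ^ k * ((n.choose i : ℝ) * a * b)
      ≤ 2 ^ (k - 1) * (‖projLeft z‖ ^ k + ‖projRight z‖ ^ k) * ((n.choose i : ℝ) * a * b) := by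
        gcongr
    _ = (n.choose i : ℝ) * (2 ^ (k - 1) *
          ((‖projLeft z‖ ^ k * a) * b + a * (‖projRight z‖ ^ k * b))) := by ring
    _ ≤ _ := by
        gcongr
        · exact hA0 k i
        · exact hA k i z
        · exact hA0 0 i
        · exact hB k (n - i) z

theorem schwartzTensor_contDiff (φ : 𝓢(EuclideanSpace ℝ ι, ℂ))
    (ψ : 𝓢(EuclideanSpace ℝ κ, ℂ)) :
    ContDiff ℝ ∞ fun z : EuclideanSpace ℝ (ι ⊕ κ) => φ (projLeft z) * ψ (projRight z) := by
  have h1 := contDiff_comp_clm (projLeft (ι := ι) (κ := κ)) φ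
  have h2 := contDiff_comp_clm (projRight (ι := ι) (κ := κ)) ψ
  exact h1.mul h2

/-- The tensor product `(φ ⊗ ψ)(x, y) = φ(x) ψ(y)` of two Schwartz functions. -/
def schwartzTensor (φ : 𝓢(EuclideanSpace ℝ ι, ℂ)) (ψ : 𝓢(EuclideanSpace ℝ κ, ℂ)) :
    𝓢(EuclideanSpace ℝ (ι ⊕ κ), ℂ) where
  toFun z := φ (projLeft z) * ψ (projRight z)
  smooth' := schwartzTensor_contDiff φ ψ
  decay' := schwartzTensor_decay φ ψ

/-- `w` is the tensor product `u ⊗ v` of the tempered distributions `u` and `v`. As the span of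
the functions `φ ⊗ ψ` is dense in the Schwartz space, this determines `w`. -/
def IsDistributionTensor (u : 𝓢'(EuclideanSpace ℝ ι, ℂ)) (v : 𝓢'(EuclideanSpace ℝ κ, ℂ))
    (w : 𝓢'(EuclideanSpace ℝ (ι ⊕ κ), ℂ)) : Prop :=
  ∀ (φ : 𝓢(EuclideanSpace ℝ ι, ℂ)) (ψ : 𝓢(EuclideanSpace ℝ κ, ℂ)),
    w (schwartzTensor φ ψ) = u φ * v ψ

end Tensor

end TMIB

end

/-! The core is a norm-bounded sequence of finite rank operators `∑ ⟨·, φ_i⟩ e_i`, with Schwartz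
`φ_i`, that converges pointwise to the identity of `E` (`exists_approximation`). Put `A_φ = ∫ φ(x)
T_x dx` and `B_h = ∫ h(ξ) M_{-ξ} dξ`. On Schwartz functions these are `χ ↦ φ * χ` and `χ ↦ ĥ χ`. The
shifts are strongly continuous with polynomial growth, so along `L¹`-normalised dilates
concentrating at `0` both families stay bounded and tend strongly to the identity. Hence so do the
composites `A_φ B_h A_φ`. Such a composite sends `χ` to `∫ ĥ(y) ⟨χ, T_y φ̌⟩ T_y φ dy`, where `φ̌` is
the reflection of `φ`. This is a Bochner integral, in operator norm, of rank one operators, so the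
composite is a norm limit of finite rank operators (`average_comp_mem_closure`). Choosing one within
`1/(m+1)` keeps both the bound and the limit. Bounded pointwise convergence is uniform on compact
sets, which gives (b). Then (a) follows with a double sequence constant in `n`.

The Bochner integral needs `φ ↦ ⟨·, φ⟩` to be continuous from `𝓢` to the normed dual `E'`, whereas
`J` only gives that each form is bounded. The short-time Fourier transform supplies this
(`continuous_evalₗ`): `φ` is a superposition of shifts of one fixed window, with rapidly decreasing
coefficients, and a shift of the window can be moved onto `e` at polynomial cost.

The same superposition gives (c). Expanding `Θ ∈ 𝓢(ℝ^{2d})` in shifts of a window `h ⊗ k` defines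
bounded bilinear forms `(e, f) ↦ ⟨e ⊗ f, Θ⟩`, hence a map on the projective tensor product.
Expanding with values in that product instead gives the inclusion of `𝓢(ℝ^{2d})`. Injectivity is
where the approximation is used: if `u` maps to `0`, then each slice `(⟨·, φ⟩ ⊗ id) u ∈ F` vanishes,
because it pairs to `0` with every test function. So `(S_m ⊗ id) u = 0` for the approximating
operators, while `(S_m ⊗ id) u → u`. -/

noncomputable section

namespace TMIB

open MeasureTheory FourierTransform

/-! ### Continuity of translations and modulations on the Schwartz space. -/

section SchwartzShifts

theorem one_add_norm_le_mul {V : Type*} [NormedAddCommGroup V] (x y : V) :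
    1 + ‖x‖ ≤ (1 + ‖y‖) * (1 + ‖x - y‖) := by
  have h : ‖x‖ ≤ ‖y‖ + ‖x - y‖ := by
    simpa using norm_add_le y (x - y)
  nlinarith [norm_nonneg y, norm_nonneg (x - y), mul_nonneg (norm_nonneg y) (norm_nonneg (x - y))]

variable {V : Type*} [NormedAddCommGroup V] [InnerProductSpace ℝ V]

/-- The translate `φ(· - x)` of a Schwartz function. -/
def schwartzTranslate (x : V) : 𝓢(V, ℂ) →L[ℂ] 𝓢(V, ℂ) := SchwartzMap.compSubConstCLM ℂ x

/-- The product of a Schwartz function with the character `t ↦ e^{2πi t·ξ}`. -/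
def schwartzModulate (ξ : V) : 𝓢(V, ℂ) →L[ℂ] 𝓢(V, ℂ) := SchwartzMap.smulLeftCLM ℂ (character ξ)

@[simp]
theorem schwartzTranslate_apply (x : V) (φ : 𝓢(V, ℂ)) (t : V) :
    schwartzTranslate x φ t = φ (t - x) := rfl

@[simp]
theorem schwartzModulate_apply (ξ : V) (φ : 𝓢(V, ℂ)) (t : V) :
    schwartzModulate ξ φ t = character ξ t * φ t := by
  simp [schwartzModulate, SchwartzMap.smulLeftCLM_apply_apply (character_hasTemperateGrowth ξ)]

theorem schwartzTranslate_zero (φ : 𝓢(V, ℂ)) : schwartzTranslate 0 φ = φ := by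
  ext t; simp

theorem schwartzTranslate_add (x y : V) (φ : 𝓢(V, ℂ)) :
    schwartzTranslate (x + y) φ = schwartzTranslate x (schwartzTranslate y φ) := by
  ext t; simp [sub_sub]

theorem translate_eq_comp (x : V) (u : 𝓢'(V, ℂ)) (φ : 𝓢(V, ℂ)) :
    translate x u φ = u (schwartzTranslate (-x) φ) := rfl

theorem modulate_eq_comp (ξ : V) (u : 𝓢'(V, ℂ)) (φ : 𝓢(V, ℂ)) :
    modulate ξ u φ = u (schwartzModulate ξ φ) := rfl

theorem iteratedFDeriv_schwartzTranslate (x : V) (φ : 𝓢(V, ℂ)) (n : ℕ) (t : V) :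
    iteratedFDeriv ℝ n (schwartzTranslate x φ) t = iteratedFDeriv ℝ n φ (t - x) :=
  iteratedFDeriv_comp_sub n x t

theorem seminorm_schwartzTranslate_le (k n : ℕ) (x : V) (φ : 𝓢(V, ℂ)) :
    SchwartzMap.seminorm ℂ k n (schwartzTranslate x φ) ≤ (1 + ‖x‖) ^ k *
      (2 ^ k * (Finset.Iic (k, n)).sup (fun m => SchwartzMap.seminorm ℂ m.1 m.2) φ) := by
  refine SchwartzMap.seminorm_le_bound ℂ k n _ (by positivity) fun t => ?_
  rw [iteratedFDeriv_schwartzTranslate]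
  have h := SchwartzMap.one_add_le_sup_seminorm_apply (𝕜 := ℂ) (m := (k, n)) le_rfl le_rfl φ (t - x)
  have ht : ‖t‖ ≤ (1 + ‖x‖) * (1 + ‖t - x‖) := by linarith [one_add_norm_le_mul t x]
  calc _ ≤ ((1 + ‖x‖) * (1 + ‖t - x‖)) ^ k * ‖iteratedFDeriv ℝ n φ (t - x)‖ := by gcongr
    _ = (1 + ‖x‖) ^ k * ((1 + ‖t - x‖) ^ k * ‖iteratedFDeriv ℝ n φ (t - x)‖) := by
        rw [mul_pow, mul_assoc]
    _ ≤ _ := by gcongr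

theorem seminorm_schwartzTranslate_sub_le (k n : ℕ) (x : V) (hx : ‖x‖ ≤ 1) (φ : 𝓢(V, ℂ)) :
    SchwartzMap.seminorm ℂ k n (schwartzTranslate x φ - φ) ≤ ‖x‖ *
      (2 ^ k * (Finset.Iic (k, n + 1)).sup (fun m => SchwartzMap.seminorm ℂ m.1 m.2) φ) := by
  refine SchwartzMap.seminorm_le_bound ℂ k n _ (by positivity) fun t => ?_
  have h1 : iteratedFDeriv ℝ n (schwartzTranslate x φ - φ : 𝓢(V, ℂ)) t =
      iteratedFDeriv ℝ n φ (t - x) - iteratedFDeriv ℝ n φ t := by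
    rw [← iteratedFDeriv_schwartzTranslate]
    exact iteratedFDeriv_sub_apply ((schwartzTranslate x φ).smooth n).contDiffAt
      (φ.smooth n).contDiffAt
  rw [h1]
  have hd : Differentiable ℝ (iteratedFDeriv ℝ n φ) :=
    (φ.smooth ⊤).differentiable_iteratedFDeriv (by exact_mod_cast WithTop.coe_lt_top n)
  -- The weight is frozen at `t`, so the mean value inequality applies to the derivative alone; on
  -- the unit ball about `t` the frozen weight is at most `(1 + ‖s‖) ^ k`.
  have h2 := (convex_closedBall t 1).norm_image_sub_le_of_norm_fderiv_le
    (f := fun s => (‖t‖ ^ k : ℝ) • iteratedFDeriv ℝ n φ s) (𝕜 := ℝ)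
    (C := 2 ^ k * (Finset.Iic (k, n + 1)).sup (fun m => SchwartzMap.seminorm ℂ m.1 m.2) φ)
    (x := t) (y := t - x)
    (fun s _ => (hd s).fun_const_smul _) (fun s hs => ?_) (by simp) (by simpa using hx)
  · rw [← smul_sub, norm_smul] at h2
    simpa [mul_comm] using h2
  · rw [fderiv_fun_const_smul (hd s), norm_smul, norm_fderiv_iteratedFDeriv]
    have h := SchwartzMap.one_add_le_sup_seminorm_apply (𝕜 := ℂ) (m := (k, n + 1)) le_rfl le_rfl φ s
    refine le_trans ?_ h
    have : ‖t‖ ≤ 1 + ‖s‖ := by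
      have h3 := norm_sub_norm_le t s
      rw [Metric.mem_closedBall, dist_comm, dist_eq_norm] at hs
      linarith
    rw [Real.norm_of_nonneg (by positivity)]
    gcongr

theorem continuous_schwartzTranslate_const (φ : 𝓢(V, ℂ)) :
    Continuous fun x : V => schwartzTranslate x φ := by
  have h0 : Tendsto (fun x : V => schwartzTranslate x φ) (𝓝 0) (𝓝 φ) := by
    rw [(schwartz_withSeminorms ℂ V ℂ).tendsto_nhds]
    rintro ⟨k, n⟩ ε hε
    set K := 2 ^ k * (Finset.Iic (k, n + 1)).sup (fun m => SchwartzMap.seminorm ℂ m.1 m.2) φ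
    have hK : Tendsto (fun x : V => ‖x‖ * K) (𝓝 0) (𝓝 0) := by
      have : Continuous fun x : V => ‖x‖ * K := by fun_prop
      simpa using this.tendsto 0
    filter_upwards [hK.eventually (gt_mem_nhds hε), Metric.closedBall_mem_nhds (0 : V) one_pos]
      with x hx hx1
    exact (seminorm_schwartzTranslate_sub_le k n x (by simpa using hx1) φ).trans_lt hx
  refine continuous_iff_continuousAt.2 fun x => ?_
  have h1 : Tendsto (fun y : V => schwartzTranslate (y - x) φ) (𝓝 x) (𝓝 φ) := by
    refine h0.comp ?_
    have : Continuous fun y : V => y - x := by fun_prop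
    simpa using this.tendsto x
  have h2 := ((schwartzTranslate x).continuous.tendsto φ).comp h1
  refine h2.congr fun y => ?_
  simp [← schwartzTranslate_add]

/-- Joint continuity: the seminorm bound is locally uniform in the shift and controls the change of
the function, and the change of the shift is the fixed-function case. -/
theorem continuous_schwartzTranslate :
    Continuous fun p : V × 𝓢(V, ℂ) => schwartzTranslate p.1 p.2 := by
  refine continuous_iff_continuousAt.2 fun ⟨x, φ⟩ => ?_
  have h1 : Tendsto (fun p : V × 𝓢(V, ℂ) => schwartzTranslate p.1 (p.2 - φ)) (𝓝 (x, φ)) (𝓝 0) := by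
    rw [(schwartz_withSeminorms ℂ V ℂ).tendsto_nhds]
    rintro ⟨k, n⟩ ε hε
    have hq : Continuous fun ψ : 𝓢(V, ℂ) =>
        (Finset.Iic (k, n)).sup (fun m => SchwartzMap.seminorm ℂ m.1 m.2) ψ := by
      have := (schwartz_withSeminorms ℂ V ℂ).finset_sups.continuous_seminorm (Finset.Iic (k, n))
      exact this
    have hc : Continuous fun p : V × 𝓢(V, ℂ) => (1 + ‖p.1‖) ^ k *
        (2 ^ k * (Finset.Iic (k, n)).sup (fun m => SchwartzMap.seminorm ℂ m.1 m.2) (p.2 - φ)) := by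
      fun_prop
    have hK := hc.tendsto (x, φ)
    simp only [sub_self, map_zero, mul_zero] at hK
    filter_upwards [hK.eventually (gt_mem_nhds hε)] with p hp
    simpa using (seminorm_schwartzTranslate_le k n p.1 (p.2 - φ)).trans_lt hp
  have h2 : Tendsto (fun p : V × 𝓢(V, ℂ) => schwartzTranslate p.1 φ) (𝓝 (x, φ))
      (𝓝 (schwartzTranslate x φ)) :=
    ((continuous_schwartzTranslate_const φ).comp continuous_fst).tendsto (x, φ)
  simpa [ContinuousAt] using h1.add h2

theorem character_eq_fourierChar (ξ t : V) : character ξ t = Real.fourierChar ⟪t, ξ⟫_ℝ := by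
  rw [Real.fourierChar_apply, character, real_inner_comm]
  congr 1
  push_cast
  ring

theorem norm_character (ξ t : V) : ‖character ξ t‖ = 1 := by
  rw [character_eq_fourierChar, Circle.norm_coe]

theorem character_neg (ξ t : V) : character (-ξ) t = Real.fourierChar (-⟪t, ξ⟫_ℝ) := by
  rw [character_eq_fourierChar, inner_neg_right]

theorem character_mul_character (ξ η t : V) :
    character ξ t * character η t = character (ξ + η) t := by
  simp only [character, ← Complex.exp_add, inner_add_left]
  congr 1
  push_cast
  ring

variable [FiniteDimensional ℝ V] [MeasurableSpace V] [BorelSpace V]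

theorem fourier_eq_integral_character (φ : 𝓢(V, ℂ)) (ξ : V) :
    𝓕 φ ξ = ∫ t, character (-ξ) t * φ t := by
  rw [SchwartzMap.fourier_coe, Real.fourier_eq]
  simp_rw [character_neg]
  rfl

theorem fourierInv_eq_integral_character (φ : 𝓢(V, ℂ)) (ξ : V) :
    𝓕⁻ φ ξ = ∫ t, character ξ t * φ t := by
  rw [SchwartzMap.fourierInv_coe, Real.fourierInv_eq]
  simp_rw [character_eq_fourierChar]
  rfl

theorem fourier_schwartzModulate (ξ : V) (φ : 𝓢(V, ℂ)) :
    𝓕 (schwartzModulate ξ φ) = schwartzTranslate ξ (𝓕 φ) := by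
  ext η
  rw [schwartzTranslate_apply, fourier_eq_integral_character, fourier_eq_integral_character]
  simp only [schwartzModulate_apply, ← mul_assoc, character_mul_character]
  congr! 4
  abel_nf

theorem schwartzModulate_eq (ξ : V) (φ : 𝓢(V, ℂ)) :
    schwartzModulate ξ φ = 𝓕⁻ (schwartzTranslate ξ (𝓕 φ)) := by
  rw [← fourier_schwartzModulate, FourierTransform.fourierInv_fourier_eq]

/-- The Fourier transform conjugates modulations into translations, so continuity is inherited. -/
theorem continuous_schwartzModulate :
    Continuous fun p : V × 𝓢(V, ℂ) => schwartzModulate p.1 p.2 := by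
  simp_rw [schwartzModulate_eq]
  have h := (FourierTransform.fourierCLM ℂ 𝓢(V, ℂ)).continuous
  have h' := (FourierTransform.fourierInvCLM ℂ 𝓢(V, ℂ)).continuous
  exact h'.comp (continuous_schwartzTranslate.comp
    (continuous_fst.prodMk (h.comp continuous_snd)))

theorem continuous_schwartzModulate_const (φ : 𝓢(V, ℂ)) :
    Continuous fun ξ : V => schwartzModulate ξ φ :=
  Continuous.comp (g := fun p : V × 𝓢(V, ℂ) => schwartzModulate p.1 p.2)
    (f := fun ξ : V => (ξ, φ)) continuous_schwartzModulate (by fun_prop)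

/-- Time-frequency shifts of a Schwartz function depend continuously on the shift. -/
theorem continuous_schwartzShift (φ : 𝓢(V, ℂ)) :
    Continuous fun p : V × V => schwartzModulate p.2 (schwartzTranslate p.1 φ) :=
  continuous_schwartzModulate.comp (continuous_snd.prodMk
    ((continuous_schwartzTranslate_const φ).comp continuous_fst))

end SchwartzShifts

/-! ### The short-time Fourier transform and superpositions of shifts. -/

section ShortTimeFourier

/-- The weight `(1 + |z|)(1 + |ζ|)` on phase space. -/
def phaseWeight {V : Type*} [NormedAddCommGroup V] (p : V × V) : ℝ := (1 + ‖p.1‖) * (1 + ‖p.2‖)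

theorem phaseWeight_pos {V : Type*} [NormedAddCommGroup V] (p : V × V) : 0 < phaseWeight p := by
  unfold phaseWeight; positivity

variable {V : Type*} [NormedAddCommGroup V] [InnerProductSpace ℝ V]

/-- The pointwise product of two Schwartz functions. -/
def schwartzMul (φ : 𝓢(V, ℂ)) : 𝓢(V, ℂ) →L[ℂ] 𝓢(V, ℂ) :=
  SchwartzMap.pairing (ContinuousLinearMap.mul ℂ ℂ) φ

@[simp]
theorem schwartzMul_apply (φ ψ : 𝓢(V, ℂ)) (t : V) : schwartzMul φ ψ t = φ t * ψ t := rfl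

theorem schwartzMul_add_left (φ φ' ψ : 𝓢(V, ℂ)) :
    schwartzMul (φ + φ') ψ = schwartzMul φ ψ + schwartzMul φ' ψ := by
  ext t; simp [add_mul]

theorem schwartzMul_smul_left (c : ℂ) (φ ψ : 𝓢(V, ℂ)) :
    schwartzMul (c • φ) ψ = c • schwartzMul φ ψ := by
  ext t; simp [mul_assoc]

theorem continuous_finset_sup_seminorm (s : Finset (ℕ × ℕ)) :
    Continuous fun φ : 𝓢(V, ℂ) => s.sup (fun m => SchwartzMap.seminorm ℂ m.1 m.2) φ :=
  (schwartz_withSeminorms ℂ V ℂ).finset_sups.continuous_seminorm s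

theorem LinearMap.continuous_of_norm_le {X : Type*} [NormedAddCommGroup X] [NormedSpace ℂ X]
    (A : 𝓢(V, ℂ) →ₗ[ℂ] X) {q : 𝓢(V, ℂ) → ℝ} (hq : Continuous q) (hq0 : q 0 = 0)
    (h : ∀ φ, ‖A φ‖ ≤ q φ) : Continuous A := by
  refine continuous_of_continuousAt_zero A ?_
  rw [ContinuousAt, map_zero]
  refine squeeze_zero_norm h ?_
  simpa [hq0] using hq.tendsto 0

/-- Since `1 + ‖z‖ ≤ (1 + ‖t‖)(1 + ‖t - z‖)`, the weight in `z` is split between the decay of `φ` at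
`t` and that of `G` at `t - z`. The bound is a continuous function of `φ` vanishing at `0`, which is
all that later continuity proofs need. -/
theorem exists_seminorm_schwartzMul_translate_le (G : 𝓢(V, ℂ)) (k n N : ℕ) :
    ∃ q : 𝓢(V, ℂ) → ℝ, Continuous q ∧ q 0 = 0 ∧ ∀ z φ, (1 + ‖z‖) ^ N *
      SchwartzMap.seminorm ℂ k n (schwartzMul φ (schwartzTranslate z G)) ≤ q φ := by
  set B : ℝ := 2 ^ N * (Finset.Iic (N, n)).sup (fun m => SchwartzMap.seminorm ℂ m.1 m.2) G
  have hB0 : 0 ≤ B := by positivity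
  set Q : 𝓢(V, ℂ) → ℝ := fun φ =>
    2 ^ (k + N) * (Finset.Iic (k + N, n)).sup (fun m => SchwartzMap.seminorm ℂ m.1 m.2) φ
  have hQ0 : ∀ φ, 0 ≤ Q φ := fun φ => by positivity
  refine ⟨fun φ => 2 ^ n * (Q φ * B), ?_, by simp [Q], fun z φ => ?_⟩
  · have := continuous_finset_sup_seminorm (V := V) (Finset.Iic (k + N, n))
    fun_prop
  have hz : 0 < (1 + ‖z‖) ^ N := by positivity
  rw [← le_div_iff₀' hz]
  refine SchwartzMap.seminorm_le_bound ℂ k n _ (by have := hQ0 φ; positivity) fun t => ?_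
  rw [le_div_iff₀' hz]
  have h := norm_iteratedFDeriv_mul_le (𝕜 := ℝ) (φ.smooth ⊤) ((schwartzTranslate z G).smooth ⊤) t
    (n := n) (by exact_mod_cast (le_top : (n : ℕ∞) ≤ ⊤))
  have hs : (2 : ℝ) ^ n * (Q φ * B) =
      ∑ i ∈ Finset.range (n + 1), (n.choose i : ℝ) * (Q φ * B) := by
    rw [← Finset.sum_mul, ← Nat.cast_sum, Nat.sum_range_choose]
    simp
  refine le_trans ?_ hs.ge
  calc (1 + ‖z‖) ^ N * (‖t‖ ^ k * ‖iteratedFDeriv ℝ n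
        (schwartzMul φ (schwartzTranslate z G)) t‖)
      ≤ (1 + ‖z‖) ^ N * (‖t‖ ^ k * ∑ i ∈ Finset.range (n + 1), (n.choose i : ℝ) *
        ‖iteratedFDeriv ℝ i φ t‖ * ‖iteratedFDeriv ℝ (n - i) (schwartzTranslate z G) t‖) := by
        gcongr
        exact h
    _ ≤ _ := by
      rw [Finset.mul_sum, Finset.mul_sum]
      refine Finset.sum_le_sum fun i hi => ?_
      have hi' : i ≤ n := Nat.lt_succ_iff.1 (Finset.mem_range.1 hi)
      rw [iteratedFDeriv_schwartzTranslate]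
      have h1 := SchwartzMap.one_add_le_sup_seminorm_apply (𝕜 := ℂ) (m := (k + N, n)) (k := k + N)
        (n := i) le_rfl hi' φ t
      have h2 := SchwartzMap.one_add_le_sup_seminorm_apply (𝕜 := ℂ) (m := (N, n)) (k := N)
        (n := n - i) le_rfl (Nat.sub_le _ _) G (t - z)
      have h3 : 1 + ‖z‖ ≤ (1 + ‖t‖) * (1 + ‖t - z‖) := by
        rw [norm_sub_rev]; exact one_add_norm_le_mul z t
      calc (1 + ‖z‖) ^ N * (‖t‖ ^ k * ((n.choose i : ℝ) * ‖iteratedFDeriv ℝ i φ t‖ *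
            ‖iteratedFDeriv ℝ (n - i) G (t - z)‖))
          ≤ ((1 + ‖t‖) * (1 + ‖t - z‖)) ^ N * ((1 + ‖t‖) ^ k * ((n.choose i : ℝ) *
            ‖iteratedFDeriv ℝ i φ t‖ * ‖iteratedFDeriv ℝ (n - i) G (t - z)‖)) := by
            gcongr
            linarith
        _ = (n.choose i : ℝ) * (((1 + ‖t‖) ^ (k + N) * ‖iteratedFDeriv ℝ i φ t‖) *
            ((1 + ‖t - z‖) ^ N * ‖iteratedFDeriv ℝ (n - i) G (t - z)‖)) := by
            rw [mul_pow, pow_add]; ring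
        _ ≤ _ := by
            gcongr

variable [FiniteDimensional ℝ V] [MeasurableSpace V] [BorelSpace V]

/-- The short-time Fourier transform of `φ` with window `G`: at `(z, ζ)` it is the Fourier
transform of `φ · G(· - z)` at `ζ`. -/
def stft (G φ : 𝓢(V, ℂ)) (p : V × V) : ℂ :=
  𝓕 (schwartzMul φ (schwartzTranslate p.1 G)) p.2

theorem stft_add (G φ φ' : 𝓢(V, ℂ)) (p : V × V) :
    stft G (φ + φ') p = stft G φ p + stft G φ' p := by
  simp [stft, schwartzMul_add_left, FourierTransform.fourier_add]

theorem stft_smul (G : 𝓢(V, ℂ)) (c : ℂ) (φ : 𝓢(V, ℂ)) (p : V × V) :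
    stft G (c • φ) p = c * stft G φ p := by
  simp [stft, schwartzMul_smul_left, FourierTransform.fourier_smul]

theorem continuous_stft (G φ : 𝓢(V, ℂ)) : Continuous (stft G φ) := by
  have h1 : Continuous fun z : V => (SchwartzMap.toBoundedContinuousFunctionCLM ℂ V ℂ)
      (FourierTransform.fourierCLM ℂ 𝓢(V, ℂ) (schwartzMul φ (schwartzTranslate z G))) := by
    have := continuous_schwartzTranslate_const G
    fun_prop
  have h2 : Continuous fun p : V × V => ((SchwartzMap.toBoundedContinuousFunctionCLM ℂ V ℂ)
      (FourierTransform.fourierCLM ℂ 𝓢(V, ℂ) (schwartzMul φ (schwartzTranslate p.1 G))), p.2) :=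
    (h1.comp continuous_fst).prodMk continuous_snd
  exact (continuous_eval (F := BoundedContinuousFunction V ℂ)).comp h2

/-- Decay in `ζ` comes from continuity of the Fourier transform in Schwartz seminorms; decay in `z`
from the preceding estimate, applied to each of the finitely many seminorms involved. -/
theorem exists_phaseWeight_mul_stft_le (G : 𝓢(V, ℂ)) (N : ℕ) :
    ∃ q : 𝓢(V, ℂ) → ℝ, Continuous q ∧ q 0 = 0 ∧ ∀ φ p,
      phaseWeight p ^ N * ‖stft G φ p‖ ≤ q φ := by
  have hcont : Continuous (((Finset.Iic (N, 0)).sup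
      (fun m => SchwartzMap.seminorm ℂ m.1 m.2)).comp
      (FourierTransform.fourierₗ ℂ 𝓢(V, ℂ) (F := 𝓢(V, ℂ)))) :=
    (continuous_finset_sup_seminorm (V := V) (Finset.Iic (N, 0))).comp
      (FourierTransform.fourierCLM ℂ 𝓢(V, ℂ)).continuous
  obtain ⟨s, C, -, hC⟩ :=
    Seminorm.bound_of_continuous (schwartz_withSeminorms ℂ V ℂ) _ hcont
  choose q hq hq0 hqle using fun i : ℕ × ℕ =>
    exists_seminorm_schwartzMul_translate_le G i.1 i.2 N
  refine ⟨fun φ => 2 ^ N * (C * ∑ i ∈ s, q i φ), by fun_prop, by simp [hq0], fun φ p => ?_⟩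
  set f := schwartzMul φ (schwartzTranslate p.1 G)
  have h1 := SchwartzMap.one_add_le_sup_seminorm_apply (𝕜 := ℂ) (m := (N, 0)) (k := N) (n := 0)
    le_rfl le_rfl (𝓕 f) p.2
  rw [norm_iteratedFDeriv_zero] at h1
  have h2 := hC f
  have h3 : s.sup (schwartzSeminormFamily ℂ V ℂ) f ≤ ∑ i ∈ s, SchwartzMap.seminorm ℂ i.1 i.2 f := by
    have := Seminorm.finset_sup_le_sum (schwartzSeminormFamily ℂ V ℂ) s f
    refine this.trans (le_of_eq ?_)
    simp only [← FunLike.coeAddMonoidHom_apply, map_sum, Finset.sum_apply]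
    rfl
  calc phaseWeight p ^ N * ‖stft G φ p‖
      = (1 + ‖p.1‖) ^ N * ((1 + ‖p.2‖) ^ N * ‖𝓕 f p.2‖) := by
        rw [phaseWeight, mul_pow, mul_assoc]; rfl
    _ ≤ (1 + ‖p.1‖) ^ N * (2 ^ N * (C * ∑ i ∈ s, SchwartzMap.seminorm ℂ i.1 i.2 f)) := by
        refine mul_le_mul_of_nonneg_left (h1.trans ?_) (by positivity)
        refine mul_le_mul_of_nonneg_left (h2.trans ?_) (by positivity)
        exact mul_le_mul_of_nonneg_left h3 C.2
    _ = 2 ^ N * (C * ∑ i ∈ s, (1 + ‖p.1‖) ^ N * SchwartzMap.seminorm ℂ i.1 i.2 f) := by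
        rw [← Finset.mul_sum]; ring
    _ ≤ _ := by
        refine mul_le_mul_of_nonneg_left (mul_le_mul_of_nonneg_left ?_ C.2) (by positivity)
        exact Finset.sum_le_sum fun i _ => hqle i p.1 φ

theorem integrable_one_add_norm_pow_inv :
    Integrable fun x : V => ((1 + ‖x‖) ^ (Module.finrank ℝ V + 1))⁻¹ := by
  have h := integrable_one_add_norm (E := V) (μ := volume)
    (r := ((Module.finrank ℝ V + 1 : ℕ) : ℝ)) (by push_cast; linarith)
  refine h.congr (Eventually.of_forall fun x => ?_)
  simp only
  rw [Real.rpow_neg (by positivity), Real.rpow_natCast]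

theorem integrable_phaseWeight_pow_inv :
    Integrable fun p : V × V => (phaseWeight p ^ (Module.finrank ℝ V + 1))⁻¹ := by
  have h := (integrable_one_add_norm_pow_inv (V := V)).mul_prod
    (integrable_one_add_norm_pow_inv (V := V))
  refine h.congr (Eventually.of_forall fun p => ?_)
  simp only [phaseWeight]
  rw [mul_pow, mul_inv]

theorem exists_norm_stft_smul_le (G : 𝓢(V, ℂ)) (N : ℕ) :
    ∃ q : 𝓢(V, ℂ) → ℝ, Continuous q ∧ q 0 = 0 ∧ ∀ φ p,
      ‖stft G φ p‖ * phaseWeight p ^ N ≤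
        q φ * (phaseWeight p ^ (Module.finrank ℝ V + 1))⁻¹ := by
  -- The surplus exponent, dimension plus one, makes the remaining inverse weight integrable in each
  -- phase space variable.
  obtain ⟨q, hq, hq0, h⟩ := exists_phaseWeight_mul_stft_le G (N + (Module.finrank ℝ V + 1))
  refine ⟨q, hq, hq0, fun φ p => ?_⟩
  have hp : 0 < phaseWeight p ^ (Module.finrank ℝ V + 1) := pow_pos (phaseWeight_pos p) _
  rw [← div_eq_mul_inv, le_div_iff₀ hp]
  refine le_trans (le_of_eq ?_) (h φ p)
  rw [pow_add]; ring

variable {X : Type*} [NormedAddCommGroup X] [NormedSpace ℂ X]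

theorem integrable_stft_smul (G φ : 𝓢(V, ℂ)) {b : V × V → X} (hb : Continuous b) {K : ℝ} {N : ℕ}
    (hK : ∀ p, ‖b p‖ ≤ K * phaseWeight p ^ N) : Integrable fun p => stft G φ p • b p := by
  obtain ⟨q, -, -, h⟩ := exists_norm_stft_smul_le G N
  have hc : Continuous fun p => stft G φ p • b p := (continuous_stft G φ).smul hb
  have hK0 : 0 ≤ K := by
    have h := (norm_nonneg _).trans (hK 0)
    exact nonneg_of_mul_nonneg_left h (pow_pos (phaseWeight_pos _) _)
  refine Integrable.mono' (integrable_phaseWeight_pow_inv.const_mul (K * q φ))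
    hc.aestronglyMeasurable (Eventually.of_forall fun p => ?_)
  rw [norm_smul]
  calc ‖stft G φ p‖ * ‖b p‖ ≤ ‖stft G φ p‖ * (K * phaseWeight p ^ N) := by gcongr; exact hK p
    _ = K * (‖stft G φ p‖ * phaseWeight p ^ N) := by ring
    _ ≤ K * (q φ * (phaseWeight p ^ (Module.finrank ℝ V + 1))⁻¹) :=
        mul_le_mul_of_nonneg_left (h φ p) hK0
    _ = _ := by ring

theorem exists_norm_integral_stft_smul_le (G : 𝓢(V, ℂ)) (N : ℕ) :
    ∃ q : 𝓢(V, ℂ) → ℝ, Continuous q ∧ q 0 = 0 ∧ ∀ (φ : 𝓢(V, ℂ)) (b : V × V → X) (K : ℝ),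
      (∀ p, ‖b p‖ ≤ K * phaseWeight p ^ N) → ‖∫ p, stft G φ p • b p‖ ≤ K * q φ := by
  obtain ⟨q, hq, hq0, h⟩ := exists_norm_stft_smul_le G N
  refine ⟨fun φ => q φ * ∫ p : V × V, (phaseWeight p ^ (Module.finrank ℝ V + 1))⁻¹,
    by fun_prop, by simp [hq0], fun φ b K hK => ?_⟩
  have hK0 : 0 ≤ K := by
    have h := (norm_nonneg _).trans (hK 0)
    exact nonneg_of_mul_nonneg_left h (pow_pos (phaseWeight_pos _) _)
  rw [← mul_assoc, ← integral_const_mul]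
  refine norm_integral_le_of_norm_le (integrable_phaseWeight_pow_inv.const_mul (K * q φ))
    (Eventually.of_forall fun p => ?_)
  rw [norm_smul]
  calc ‖stft G φ p‖ * ‖b p‖ ≤ ‖stft G φ p‖ * (K * phaseWeight p ^ N) := by gcongr; exact hK p
    _ = K * (‖stft G φ p‖ * phaseWeight p ^ N) := by ring
    _ ≤ K * (q φ * (phaseWeight p ^ (Module.finrank ℝ V + 1))⁻¹) :=
        mul_le_mul_of_nonneg_left (h φ p) hK0
    _ = _ := by ring

/-- Superposition `φ ↦ ∫ V_G φ(z, ζ) b(z, ζ) dz dζ` as a linear map. -/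
def synthesisₗ (G : 𝓢(V, ℂ)) (b : V × V → X) (hb : Continuous b) (K : ℝ) (N : ℕ)
    (hK : ∀ p, ‖b p‖ ≤ K * phaseWeight p ^ N) : 𝓢(V, ℂ) →ₗ[ℂ] X where
  toFun φ := ∫ p, stft G φ p • b p
  map_add' φ φ' := by
    rw [← integral_add (integrable_stft_smul G φ hb hK) (integrable_stft_smul G φ' hb hK)]
    simp [stft_add, add_smul]
  map_smul' c φ := by
    rw [RingHom.id_apply, ← integral_smul]
    simp [stft_smul, mul_smul]

/-- Superposition `φ ↦ ∫ V_G φ(z, ζ) b(z, ζ) dz dζ` of a continuous polynomially bounded family. -/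
def synthesis (G : 𝓢(V, ℂ)) (b : V × V → X) (hb : Continuous b) (K : ℝ) (N : ℕ)
    (hK : ∀ p, ‖b p‖ ≤ K * phaseWeight p ^ N) : 𝓢(V, ℂ) →L[ℂ] X where
  toLinearMap := synthesisₗ G b hb K N hK
  cont := by
    obtain ⟨q, hq, hq0, h⟩ := exists_norm_integral_stft_smul_le (X := X) G N
    exact LinearMap.continuous_of_norm_le (synthesisₗ G b hb K N hK) (hq.const_mul K)
      (by simp [hq0]) fun φ => h φ b K hK

theorem synthesis_apply (G : 𝓢(V, ℂ)) (b : V × V → X) (hb : Continuous b) (K : ℝ) (N : ℕ)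
    (hK : ∀ p, ‖b p‖ ≤ K * phaseWeight p ^ N) (φ : 𝓢(V, ℂ)) :
    synthesis G b hb K N hK φ = ∫ p, stft G φ p • b p := rfl

theorem map_synthesis {Y : Type*} [NormedAddCommGroup Y] [NormedSpace ℂ Y] [CompleteSpace X]
    [CompleteSpace Y] (A : X →L[ℂ] Y) (G : 𝓢(V, ℂ)) (b : V × V → X) (hb : Continuous b) (K : ℝ)
    (N : ℕ) (hK : ∀ p, ‖b p‖ ≤ K * phaseWeight p ^ N) (φ : 𝓢(V, ℂ)) :
    A (synthesis G b hb K N hK φ) = ∫ p, stft G φ p • A (b p) := by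
  rw [synthesis_apply, ← A.integral_comp_comm (integrable_stft_smul G φ hb hK)]
  simp

/-- The pairing `∫ φ ψ` of two Schwartz functions. -/
theorem toTemperedDistributionCLM_apply_eq (φ ψ : 𝓢(V, ℂ)) :
    SchwartzMap.toTemperedDistributionCLM V ℂ volume φ ψ = ∫ t, φ t * ψ t := by
  refine (SchwartzMap.toTemperedDistributionCLM_apply_apply volume φ ψ).trans ?_
  simp [mul_comm]

theorem integrable_mul (φ ψ : 𝓢(V, ℂ)) : Integrable fun t => φ t * ψ t :=
  (schwartzMul φ ψ).integrable

theorem norm_integral_mul_shift_le (φ H : 𝓢(V, ℂ)) (p : V × V) :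
    ‖∫ t, φ t * schwartzModulate p.2 (schwartzTranslate p.1 H) t‖ ≤
      (∫ t, ‖φ t‖) * SchwartzMap.seminorm ℂ 0 0 H := by
  rw [← integral_mul_const]
  refine norm_integral_le_of_norm_le (φ.integrable.norm.mul_const _)
    (Eventually.of_forall fun t => ?_)
  simp only [norm_mul, schwartzModulate_apply, norm_character, one_mul, schwartzTranslate_apply]
  gcongr
  exact SchwartzMap.norm_le_seminorm ℂ H _

/-- The reproducing formula of the short-time Fourier transform in weak form. -/
theorem integral_stft_mul (G H φ ψ : 𝓢(V, ℂ)) (hGH : ∫ t, G t * H t = 1) :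
    ∫ p, stft G φ p * ∫ t, ψ t * schwartzModulate p.2 (schwartzTranslate p.1 H) t =
      ∫ t, ψ t * φ t := by
  have hc : Continuous fun p : V × V =>
      ∫ t, ψ t * schwartzModulate p.2 (schwartzTranslate p.1 H) t := by
    have := (SchwartzMap.toTemperedDistributionCLM V ℂ volume ψ).continuous.comp
      (continuous_schwartzShift H)
    exact this.congr fun p => toTemperedDistributionCLM_apply_eq ψ _
  have hfi := integrable_stft_smul G φ hc (K := (∫ t, ‖ψ t‖) * SchwartzMap.seminorm ℂ 0 0 H)
    (N := 0) (fun p => by simpa using norm_integral_mul_shift_le ψ H p)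
  simp only [smul_eq_mul] at hfi
  -- For fixed `z` the pairing with the shifted window is an inverse Fourier transform in `ζ`, so
  -- moving the Fourier transform across the integral removes `ζ`.
  have h1 : ∀ z : V, ∫ ζ, stft G φ (z, ζ) *
      ∫ t, ψ t * schwartzModulate ζ (schwartzTranslate z H) t =
      ∫ t, (ψ t * φ t) * (G (t - z) * H (t - z)) := by
    intro z
    have h2 : ∀ ζ, ∫ t, ψ t * schwartzModulate ζ (schwartzTranslate z H) t =
        𝓕⁻ (schwartzMul ψ (schwartzTranslate z H)) ζ := fun ζ => by
      rw [fourierInv_eq_integral_character]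
      refine integral_congr_ae (Eventually.of_forall fun t => ?_)
      simp only [schwartzModulate_apply, schwartzMul_apply]
      ring
    simp_rw [h2, stft]
    rw [SchwartzMap.integral_fourier_mul_eq, FourierTransform.fourier_fourierInv_eq]
    refine integral_congr_ae (Eventually.of_forall fun t => ?_)
    simp only [schwartzMul_apply, schwartzTranslate_apply]
    ring
  rw [Measure.volume_eq_prod, integral_prod _ hfi]
  simp_rw [h1]
  -- This is the convolution integrand of `ψ φ` with the reflection of `G H`, hence jointly
  -- integrable; after the swap the `z`-integral is `∫ G H = 1`.
  have hswap : Integrable (Function.uncurry fun z t : V =>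
      (ψ t * φ t) * (G (t - z) * H (t - z))) (volume.prod volume) := by
    have := (Integrable.convolution_integrand (ContinuousLinearMap.mul ℂ ℂ) (μ := volume)
      (ν := (volume : Measure V)) (integrable_mul ψ φ) (integrable_mul G H).comp_neg)
    refine this.congr (Eventually.of_forall fun p => ?_)
    simp [Function.uncurry]
  rw [integral_integral_swap hswap]
  have h3 : ∀ t : V, ∫ z, (ψ t * φ t) * (G (t - z) * H (t - z)) = ψ t * φ t := fun t => by
    rw [integral_const_mul, integral_sub_left_eq_self (fun s => G s * H s), hGH, mul_one]
  simp_rw [h3]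

end ShortTimeFourier

/-! ### Dual windows, and density of the Schwartz functions in the tempered distributions. -/

section Windows

variable {V : Type*} [NormedAddCommGroup V] [InnerProductSpace ℝ V] [FiniteDimensional ℝ V]
  [MeasurableSpace V] [BorelSpace V]

theorem exists_schwartz_integral_eq_one : ∃ h : 𝓢(V, ℂ), ∫ t, h t = 1 := by
  let b : ContDiffBump (0 : V) := ⟨1, 2, one_pos, one_lt_two⟩
  have h1 : HasCompactSupport fun t => (b.normed volume t : ℂ) :=
    b.hasCompactSupport_normed.comp_left (g := fun r : ℝ => (r : ℂ)) (by simp)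
  have h2 : ContDiff ℝ ∞ fun t => (b.normed volume t : ℂ) :=
    Complex.ofRealCLM.contDiff.comp b.contDiff_normed
  refine ⟨h1.toSchwartzMap h2, ?_⟩
  have h3 : ∫ t, (b.normed volume t : ℂ) = 1 := by
    rw [integral_complex_ofReal, b.integral_normed]; simp
  exact h3

/-- The pairing is bilinear, so `G` is the complex conjugate of `H` divided by `∫ ‖H‖²`. -/
theorem exists_integral_mul_eq_one {H : 𝓢(V, ℂ)} (hH : H ≠ 0) :
    ∃ G : 𝓢(V, ℂ), ∫ t, G t * H t = 1 := by
  obtain ⟨t₀, ht₀⟩ : ∃ t, H t ≠ 0 := by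
    by_contra! h
    exact hH (SchwartzMap.ext h)
  let H' : 𝓢(V, ℂ) := SchwartzMap.postcompCLM (Complex.conjCLE : ℂ →L[ℝ] ℂ) H
  have hH' : ∀ t, H' t * H t = ((‖H t‖ ^ 2 : ℝ) : ℂ) := fun t => by
    simp [H', SchwartzMap.postcompCLM_apply, ← Complex.normSq_eq_conj_mul_self,
      Complex.normSq_eq_norm_sq]
  have hpos : 0 < ∫ t, ‖H t‖ ^ 2 := by
    have hi : Integrable fun t => ‖H t‖ ^ 2 := by
      have := (integrable_mul H' H).norm
      refine this.congr (Eventually.of_forall fun t => ?_)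
      simp only [hH']
      simp
    rw [integral_pos_iff_support_of_nonneg (fun t => by positivity) hi]
    have hc : Continuous fun t => ‖H t‖ ^ 2 := by fun_prop
    exact hc.isOpen_support.measure_pos volume ⟨t₀, by simpa using ht₀⟩
  refine ⟨((∫ t, ‖H t‖ ^ 2 : ℝ) : ℂ)⁻¹ • H', ?_⟩
  have : ∀ t, (((∫ t, ‖H t‖ ^ 2 : ℝ) : ℂ)⁻¹ • H') t * H t =
      ((∫ t, ‖H t‖ ^ 2 : ℝ) : ℂ)⁻¹ * ((‖H t‖ ^ 2 : ℝ) : ℂ) := fun t => by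
    rw [← hH', ← mul_assoc]; rfl
  simp_rw [this]
  rw [integral_const_mul, integral_complex_ofReal]
  exact inv_mul_cancel₀ (by exact_mod_cast hpos.ne')

theorem eq_zero_of_integral_mul_eq_zero {H : 𝓢(V, ℂ)} (h : ∀ G : 𝓢(V, ℂ), ∫ t, G t * H t = 0) :
    H = 0 := by
  by_contra hH
  obtain ⟨G, hG⟩ := exists_integral_mul_eq_one hH
  exact zero_ne_one ((h G).symm.trans hG)

/-- On a finite dimensional space of test functions every linear form is the integral against a
Schwartz function. -/
theorem exists_schwartz_pairing_eq (W : Submodule ℂ 𝓢(V, ℂ)) [FiniteDimensional ℂ W]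
    (u : 𝓢(V, ℂ) →ₗ[ℂ] ℂ) : ∃ χ : 𝓢(V, ℂ), ∀ φ ∈ W, ∫ t, χ t * φ t = u φ := by
  let B : 𝓢(V, ℂ) →ₗ[ℂ] W →ₗ[ℂ] ℂ := LinearMap.mk₂ ℂ (fun χ φ => ∫ t, χ t * (φ : 𝓢(V, ℂ)) t)
    (fun χ χ' φ => by
      rw [← integral_add (integrable_mul _ _) (integrable_mul _ _)]
      simp [add_mul])
    (fun c χ φ => by
      rw [← integral_smul]; simp [mul_assoc])
    (fun χ φ φ' => by
      rw [← integral_add (integrable_mul _ _) (integrable_mul _ _)]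
      simp [mul_add])
    (fun c χ φ => by
      rw [← integral_smul]; simp [mul_left_comm])
  have hB : ∀ χ φ, B χ φ = ∫ t, χ t * (φ : 𝓢(V, ℂ)) t := fun _ _ => rfl
  have hker : LinearMap.ker B.flip = ⊥ := by
    refine LinearMap.ker_eq_bot'.2 fun φ hφ => ?_
    refine Subtype.ext (eq_zero_of_integral_mul_eq_zero fun G => ?_)
    exact LinearMap.congr_fun hφ G
  -- The pairing separates the points of `W`, so the range of `B` has trivial coannihilator; in the
  -- dual of a finite dimensional space this forces it to be everything.
  have htop : LinearMap.range B = ⊤ := by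
    have h1 := Subspace.dualCoannihilator_dualAnnihilator_eq (W := LinearMap.range B)
    rw [LinearMap.dualCoannihilator_range_eq_ker_flip, hker, Submodule.dualAnnihilator_bot] at h1
    exact h1.symm
  obtain ⟨χ, hχ⟩ := LinearMap.range_eq_top.1 htop (u ∘ₗ W.subtype)
  exact ⟨χ, fun φ hφ => LinearMap.congr_fun hχ ⟨φ, hφ⟩⟩

/-- A basic neighbourhood for pointwise convergence involves finitely many test functions, and on
their span `u` coincides with a Schwartz function. -/
theorem denseRange_toTemperedDistributionCLM :
    DenseRange (SchwartzMap.toTemperedDistributionCLM V ℂ volume) := by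
  intro u
  have hind := (PointwiseConvergenceCLM.isEmbedding_coeFn (RingHom.id ℂ) 𝓢(V, ℂ) ℂ).isInducing
  rw [hind.closure_eq_preimage_closure_image]
  rw [Set.mem_preimage, mem_closure_iff]
  intro o ho huo
  obtain ⟨I, s, hs, hIs⟩ := isOpen_pi_iff.1 ho _ huo
  have : FiniteDimensional ℂ (Submodule.span ℂ (I : Set 𝓢(V, ℂ))) :=
    FiniteDimensional.span_finset ℂ I
  obtain ⟨χ, hχ⟩ := exists_schwartz_pairing_eq (Submodule.span ℂ (I : Set 𝓢(V, ℂ)))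
    (PointwiseConvergenceCLM.coeLM ℂ 𝓢(V, ℂ) ℂ u)
  refine ⟨_, hIs ?_, _, ⟨χ, rfl⟩, rfl⟩
  intro φ hφ
  have h := toTemperedDistributionCLM_apply_eq χ φ
  rw [hχ φ (Submodule.subset_span hφ)] at h
  rw [h]
  exact (hs φ hφ).2

end Windows

/-! ### Bounded shift operators on a TMIB space, and continuity of the evaluation forms. -/

section Realization

variable {ι : Type*} [Fintype ι] {E : Type*} [NormedAddCommGroup E] [NormedSpace ℂ E]

/-- The inclusion of the Schwartz space into a TMIB space, and the translations and modulations as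
bounded operators on it. -/
structure Realization (J : E →L[ℂ] 𝓢'(EuclideanSpace ℝ ι, ℂ)) where
  /-- The inclusion `𝓢 ⊆ E`. -/
  incl : 𝓢(EuclideanSpace ℝ ι, ℂ) →L[ℂ] E
  /-- The operator `T_x` on `E`. -/
  T : EuclideanSpace ℝ ι → E →L[ℂ] E
  /-- The operator `M_ξ` on `E`. -/
  M : EuclideanSpace ℝ ι → E →L[ℂ] E
  /-- The constant in the bounds of the operators. -/
  C : ℝ
  /-- The exponent in the bounds of the operators. -/
  N : ℕ
  complete : CompleteSpace E
  injective : Function.Injective J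
  apply_incl : ∀ φ, J (incl φ) =
    SchwartzMap.toTemperedDistributionCLM (EuclideanSpace ℝ ι) ℂ volume φ
  dense_incl : DenseRange incl
  apply_T : ∀ x e, J (T x e) = translate x (J e)
  apply_M : ∀ ξ e, J (M ξ e) = modulate ξ (J e)
  norm_T_le : ∀ x, ‖T x‖ ≤ C * (1 + ‖x‖) ^ N
  norm_M_le : ∀ ξ, ‖M ξ‖ ≤ C * (1 + ‖ξ‖) ^ N

theorem exists_operator_of_invariant {J : E →L[ℂ] 𝓢'(EuclideanSpace ℝ ι, ℂ)}
    (hJ : Function.Injective J) (A : 𝓢'(EuclideanSpace ℝ ι, ℂ) →L[ℂ] 𝓢'(EuclideanSpace ℝ ι, ℂ))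
    (hA : ∀ e, A (J e) ∈ Set.range J) {B : ℝ} (hB : 0 ≤ B)
    (hbound : ∀ e e', J e' = A (J e) → ‖e'‖ ≤ B * ‖e‖) :
    ∃ U : E →L[ℂ] E, (∀ e, J (U e) = A (J e)) ∧ ‖U‖ ≤ B := by
  choose f hf using hA
  let U : E →ₗ[ℂ] E :=
    { toFun := f
      map_add' := fun e e' => hJ (by simp [hf])
      map_smul' := fun c e => hJ (by simp [hf]) }
  exact ⟨U.mkContinuous B fun e => hbound e _ (hf e), hf, U.mkContinuous_norm_le hB _⟩

theorem IsTMIB.nonempty_realization {J : E →L[ℂ] 𝓢'(EuclideanSpace ℝ ι, ℂ)} (hJ : IsTMIB J) :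
    Nonempty (Realization J) := by
  obtain ⟨j, hj, hjd⟩ := hJ.schwartz
  obtain ⟨τ, hτ, C, hC, hT, hM⟩ := hJ.growth
  -- Natural exponents fit the polynomial weights; rounding up is harmless because `1 + ‖x‖ ≥ 1`.
  have hle : ∀ x : EuclideanSpace ℝ ι, C * (1 + ‖x‖) ^ τ ≤ C * (1 + ‖x‖) ^ ⌈τ⌉₊ := fun x => by
    gcongr
    rw [← Real.rpow_natCast]
    exact Real.rpow_le_rpow_of_exponent_le (by linarith [norm_nonneg x]) (Nat.le_ceil τ)
  choose T hT1 hT2 using fun x => exists_operator_of_invariant hJ.injective (translate x)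
    (hJ.translate_mem x) (B := C * (1 + ‖x‖) ^ τ) (by positivity) (hT x)
  choose M hM1 hM2 using fun ξ => exists_operator_of_invariant hJ.injective (modulate ξ)
    (hJ.modulate_mem ξ) (B := C * (1 + ‖ξ‖) ^ τ) (by positivity)
    (fun e e' h => by simpa using hM (-ξ) e e' (by simpa using h))
  exact ⟨⟨j, T, M, C, ⌈τ⌉₊, hJ.complete, hJ.injective, hj, hjd, hT1, hM1,
    fun x => (hT2 x).trans (hle x), fun ξ => (hM2 ξ).trans (hle ξ)⟩⟩

theorem continuous_apply_of_dense {V : Type*} [NormedAddCommGroup V] {S : Type*}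
    {j : S → E} (hj : DenseRange j) (U : V → E →L[ℂ] E) {C : ℝ} {N : ℕ}
    (hU : ∀ x, ‖U x‖ ≤ C * (1 + ‖x‖) ^ N) (hc : ∀ s, Continuous fun x => U x (j s)) (e : E) :
    Continuous fun x => U x e := by
  refine continuous_iff_continuousAt.2 fun x₀ => Metric.tendsto_nhds.2 fun ε hε => ?_
  have hC : 0 ≤ C := by
    have h := (norm_nonneg _).trans (hU 0)
    simpa using h
  set B := C * (2 + ‖x₀‖) ^ N
  have hB : 0 ≤ B := by positivity
  have hle : ∀ x ∈ Metric.ball x₀ 1, ‖U x‖ ≤ B := fun x hx => by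
    refine (hU x).trans ?_
    have : ‖x‖ ≤ 1 + ‖x₀‖ := by
      have h1 := norm_sub_norm_le x x₀
      rw [Metric.mem_ball, dist_eq_norm] at hx
      linarith
    refine mul_le_mul_of_nonneg_left ?_ hC
    gcongr ?_ ^ N
    linarith
  obtain ⟨s, hs⟩ := hj.exists_dist_lt e (show 0 < ε / (3 * (B + 1)) by positivity)
  rw [dist_eq_norm] at hs
  have hsmall : ∀ x ∈ Metric.ball x₀ 1, ‖U x (e - j s)‖ ≤ ε / 3 := fun x hx => by
    calc _ ≤ ‖U x‖ * ‖e - j s‖ := ContinuousLinearMap.le_opNorm _ _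
      _ ≤ (B + 1) * (ε / (3 * (B + 1))) := by
        gcongr
        linarith [hle x hx]
      _ = ε / 3 := by field_simp
  filter_upwards [Metric.ball_mem_nhds x₀ one_pos,
    Metric.tendsto_nhds.1 ((hc s).tendsto x₀) (ε / 3) (by positivity)] with x hx hx'
  rw [dist_eq_norm] at hx' ⊢
  have h1 := hsmall x hx
  have h2 := hsmall x₀ (Metric.mem_ball_self one_pos)
  calc ‖U x e - U x₀ e‖ = ‖U x (e - j s) + (U x (j s) - U x₀ (j s)) - U x₀ (e - j s)‖ := by
        rw [map_sub, map_sub]; congr 1; abel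
    _ ≤ ‖U x (e - j s)‖ + ‖U x (j s) - U x₀ (j s)‖ + ‖U x₀ (e - j s)‖ :=
        (norm_sub_le _ _).trans (by gcongr; exact norm_add_le _ _)
    _ < ε := by linarith

namespace Realization

variable {J : E →L[ℂ] 𝓢'(EuclideanSpace ℝ ι, ℂ)} (R : Realization J)

theorem C_nonneg : 0 ≤ R.C := by
  have h := (norm_nonneg _).trans (R.norm_T_le 0)
  simpa using h

theorem apply_incl_apply (φ ψ : 𝓢(EuclideanSpace ℝ ι, ℂ)) :
    J (R.incl φ) ψ = ∫ t, φ t * ψ t := by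
  rw [R.apply_incl, toTemperedDistributionCLM_apply_eq]

theorem translate_toTemperedDistribution {V : Type*} [NormedAddCommGroup V]
    [InnerProductSpace ℝ V] [FiniteDimensional ℝ V] [MeasurableSpace V] [BorelSpace V]
    (x : V) (φ : 𝓢(V, ℂ)) :
    translate x (SchwartzMap.toTemperedDistributionCLM V ℂ volume φ) =
      SchwartzMap.toTemperedDistributionCLM V ℂ volume (schwartzTranslate x φ) := by
  refine DFunLike.ext _ _ fun ψ => ?_
  rw [translate_eq_comp, toTemperedDistributionCLM_apply_eq, toTemperedDistributionCLM_apply_eq,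
    ← integral_sub_right_eq_self _ x]
  simp

theorem modulate_toTemperedDistribution {V : Type*} [NormedAddCommGroup V]
    [InnerProductSpace ℝ V] [FiniteDimensional ℝ V] [MeasurableSpace V] [BorelSpace V]
    (ξ : V) (φ : 𝓢(V, ℂ)) :
    modulate ξ (SchwartzMap.toTemperedDistributionCLM V ℂ volume φ) =
      SchwartzMap.toTemperedDistributionCLM V ℂ volume (schwartzModulate ξ φ) := by
  refine DFunLike.ext _ _ fun ψ => ?_
  rw [modulate_eq_comp, toTemperedDistributionCLM_apply_eq, toTemperedDistributionCLM_apply_eq]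
  refine integral_congr_ae (Eventually.of_forall fun t => ?_)
  simp only [schwartzModulate_apply]
  ring

theorem T_incl (x : EuclideanSpace ℝ ι) (φ : 𝓢(EuclideanSpace ℝ ι, ℂ)) :
    R.T x (R.incl φ) = R.incl (schwartzTranslate x φ) :=
  R.injective (by rw [R.apply_T, R.apply_incl, R.apply_incl, translate_toTemperedDistribution])

theorem M_incl (ξ : EuclideanSpace ℝ ι) (φ : 𝓢(EuclideanSpace ℝ ι, ℂ)) :
    R.M ξ (R.incl φ) = R.incl (schwartzModulate ξ φ) :=
  R.injective (by rw [R.apply_M, R.apply_incl, R.apply_incl, modulate_toTemperedDistribution])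

theorem T_zero (e : E) : R.T 0 e = e := by
  refine R.injective ?_
  rw [R.apply_T]
  refine DFunLike.ext _ _ fun ψ => ?_
  rw [translate_eq_comp, neg_zero, schwartzTranslate_zero]

theorem M_zero (e : E) : R.M 0 e = e := by
  refine R.injective ?_
  rw [R.apply_M]
  refine DFunLike.ext _ _ fun ψ => ?_
  rw [modulate_eq_comp]
  congr 1
  ext t
  simp [character]

theorem apply_shift (e : E) (p : EuclideanSpace ℝ ι × EuclideanSpace ℝ ι)
    (H : 𝓢(EuclideanSpace ℝ ι, ℂ)) :
    J e (schwartzModulate p.2 (schwartzTranslate p.1 H)) = J (R.T (-p.1) (R.M p.2 e)) H := by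
  rw [R.apply_T, translate_eq_comp, R.apply_M, modulate_eq_comp, neg_neg]

variable (J) in
/-- The continuous linear form `e ↦ ⟨e, φ⟩` on `E`. -/
def evalₗ : 𝓢(EuclideanSpace ℝ ι, ℂ) →ₗ[ℂ] E →L[ℂ] ℂ where
  toFun φ := (PointwiseConvergenceCLM.evalCLM (RingHom.id ℂ) ℂ φ).comp J
  map_add' φ ψ := by
    ext e
    exact map_add (PointwiseConvergenceCLM.coeLM ℂ _ ℂ (J e)) φ ψ
  map_smul' c φ := by
    ext e
    exact map_smul (PointwiseConvergenceCLM.coeLM ℂ _ ℂ (J e)) c φ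

theorem evalₗ_apply (φ : 𝓢(EuclideanSpace ℝ ι, ℂ)) (e : E) : evalₗ J φ e = J e φ := rfl

theorem norm_shift_le (p : EuclideanSpace ℝ ι × EuclideanSpace ℝ ι) :
    ‖R.T (-p.1)‖ * ‖R.M p.2‖ ≤ R.C ^ 2 * phaseWeight p ^ R.N := by
  have h1 := R.norm_T_le (-p.1)
  rw [norm_neg] at h1
  calc _ ≤ (R.C * (1 + ‖p.1‖) ^ R.N) * (R.C * (1 + ‖p.2‖) ^ R.N) := by
        gcongr
        · have := R.C_nonneg; positivity
        · exact R.norm_M_le _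
    _ = _ := by rw [phaseWeight, mul_pow]; ring

/-- By duality the shift of `H` acts on `e` instead, where the growth condition bounds it. -/
theorem norm_evalₗ_shift_le (H : 𝓢(EuclideanSpace ℝ ι, ℂ))
    (p : EuclideanSpace ℝ ι × EuclideanSpace ℝ ι) :
    ‖evalₗ J (schwartzModulate p.2 (schwartzTranslate p.1 H))‖ ≤
      ‖evalₗ J H‖ * R.C ^ 2 * phaseWeight p ^ R.N := by
  have h0 : 0 ≤ phaseWeight p := (phaseWeight_pos p).le
  refine ContinuousLinearMap.opNorm_le_bound _ (by positivity) fun e => ?_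
  rw [evalₗ_apply, R.apply_shift, ← evalₗ_apply]
  calc _ ≤ ‖evalₗ J H‖ * (‖R.T (-p.1)‖ * (‖R.M p.2‖ * ‖e‖)) := by
        refine (ContinuousLinearMap.le_opNorm _ _).trans ?_
        gcongr
        refine (ContinuousLinearMap.le_opNorm _ _).trans ?_
        gcongr
        exact ContinuousLinearMap.le_opNorm _ _
    _ = ‖evalₗ J H‖ * (‖R.T (-p.1)‖ * ‖R.M p.2‖) * ‖e‖ := by ring
    _ ≤ ‖evalₗ J H‖ * (R.C ^ 2 * phaseWeight p ^ R.N) * ‖e‖ := by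
        refine mul_le_mul_of_nonneg_right ?_ (norm_nonneg e)
        exact mul_le_mul_of_nonneg_left (R.norm_shift_le p) (norm_nonneg _)
    _ = _ := by ring

/-- Expanding `φ` in shifts of one window `h` bounds `⟨e, φ⟩` by the single norm `‖evalₗ J h‖`, the
growth of the shifts, and a weighted integral of the short-time Fourier transform of `φ`. The
expansion is available when `e` is a Schwartz function; the resulting inequality passes to all of
`E` by density. -/
theorem continuous_evalₗ (R : Realization J) : Continuous (evalₗ J) := by
  obtain ⟨h, hh⟩ := exists_schwartz_integral_eq_one (V := EuclideanSpace ℝ ι)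
  have hh0 : h ≠ 0 := by
    rintro rfl
    simp at hh
  obtain ⟨G, hG⟩ := exists_integral_mul_eq_one hh0
  obtain ⟨q, hq, hq0, hle⟩ := exists_norm_integral_stft_smul_le (X := ℂ) G R.N
  set K := ‖evalₗ J h‖ * R.C ^ 2
  have hK0 : 0 ≤ K := by positivity
  have key : ∀ φ e, ‖J e φ‖ ≤ K * q φ * ‖e‖ := by
    intro φ e
    refine R.dense_incl.induction_on (p := fun e => ‖evalₗ J φ e‖ ≤ K * q φ * ‖e‖) e
      (isClosed_le (by fun_prop) (by fun_prop)) fun χ => ?_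
    rw [evalₗ_apply, R.apply_incl_apply, ← integral_stft_mul G h φ χ hG]
    have := hle φ (fun p => ∫ t, χ t * schwartzModulate p.2 (schwartzTranslate p.1 h) t)
      (K * ‖R.incl χ‖) (fun p => by
        rw [← R.apply_incl_apply, ← evalₗ_apply]
        refine (ContinuousLinearMap.le_opNorm _ _).trans ?_
        calc _ ≤ (‖evalₗ J h‖ * R.C ^ 2 * phaseWeight p ^ R.N) * ‖R.incl χ‖ := by
              gcongr
              exact R.norm_evalₗ_shift_le h p
          _ = _ := by ring)
    refine this.trans (le_of_eq ?_)
    ring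
  have hq' : ∀ φ, 0 ≤ K * |q φ| := fun φ => by positivity
  refine LinearMap.continuous_of_norm_le (evalₗ J) (q := fun φ => K * |q φ|) (by fun_prop)
    (by simp [hq0]) fun φ => ?_
  refine ContinuousLinearMap.opNorm_le_bound _ (hq' φ) fun e => (key φ e).trans ?_
  gcongr
  exact le_abs_self _

/-- The map `𝓢 → E'` that sends `φ` to `e ↦ ⟨e, φ⟩`. -/
def ev (R : Realization J) : 𝓢(EuclideanSpace ℝ ι, ℂ) →L[ℂ] E →L[ℂ] ℂ :=
  ⟨evalₗ J, R.continuous_evalₗ⟩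

theorem ev_apply (φ : 𝓢(EuclideanSpace ℝ ι, ℂ)) (e : E) : R.ev φ e = J e φ := rfl

theorem norm_ev_shift_le (H : 𝓢(EuclideanSpace ℝ ι, ℂ))
    (p : EuclideanSpace ℝ ι × EuclideanSpace ℝ ι) :
    ‖R.ev (schwartzModulate p.2 (schwartzTranslate p.1 H))‖ ≤
      ‖R.ev H‖ * R.C ^ 2 * phaseWeight p ^ R.N := R.norm_evalₗ_shift_le H p

theorem norm_incl_shift_le (H : 𝓢(EuclideanSpace ℝ ι, ℂ))
    (p : EuclideanSpace ℝ ι × EuclideanSpace ℝ ι) :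
    ‖R.incl (schwartzModulate p.2 (schwartzTranslate p.1 H))‖ ≤
      ‖R.incl H‖ * R.C ^ 2 * phaseWeight p ^ R.N := by
  rw [← R.M_incl, ← R.T_incl]
  have h0 := R.C_nonneg
  calc _ ≤ ‖R.M p.2‖ * (‖R.T p.1‖ * ‖R.incl H‖) := by
        refine (ContinuousLinearMap.le_opNorm _ _).trans ?_
        gcongr
        exact ContinuousLinearMap.le_opNorm _ _
    _ ≤ (R.C * (1 + ‖p.2‖) ^ R.N) * ((R.C * (1 + ‖p.1‖) ^ R.N) * ‖R.incl H‖) := by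
        gcongr
        · exact R.norm_M_le _
        · exact R.norm_T_le _
    _ = _ := by rw [phaseWeight, mul_pow]; ring

theorem continuous_T (e : E) : Continuous fun x => R.T x e :=
  continuous_apply_of_dense R.dense_incl R.T R.norm_T_le (fun φ => by
    simp_rw [R.T_incl]
    exact R.incl.continuous.comp (continuous_schwartzTranslate_const φ)) e

theorem continuous_M (e : E) : Continuous fun ξ => R.M ξ e :=
  continuous_apply_of_dense R.dense_incl R.M R.norm_M_le (fun φ => by
    simp_rw [R.M_incl]
    exact R.incl.continuous.comp (continuous_schwartzModulate_const φ)) e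

end Realization

end Realization

/-! ### Averages of polynomially bounded operator families. -/

/-- A strongly continuous family of operators on `E` whose norm grows at most polynomially. -/
structure OperatorFamily (V : Type*) [NormedAddCommGroup V]
    (E : Type*) [NormedAddCommGroup E] [NormedSpace ℂ E] where
  /-- The operators of the family. -/
  op : V → E →L[ℂ] E
  /-- The constant of the bound. -/
  C : ℝ
  /-- The exponent of the bound. -/
  N : ℕ
  norm_le : ∀ x, ‖op x‖ ≤ C * (1 + ‖x‖) ^ N
  continuous_apply : ∀ e, Continuous fun x => op x e

section OperatorFamily

variable {E : Type*} [NormedAddCommGroup E] [NormedSpace ℂ E]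

namespace OperatorFamily

variable {V : Type*} [NormedAddCommGroup V] (U : OperatorFamily V E)

theorem C_nonneg (U : OperatorFamily V E) : 0 ≤ U.C := by
  have h := (norm_nonneg _).trans (U.norm_le 0)
  simpa using h

theorem norm_smul_apply_le [NormedSpace ℝ V] (h : 𝓢(V, ℂ)) (e : E) (x : V) :
    ‖h x • U.op x e‖ ≤ (‖h x‖ * (1 + ‖x‖) ^ U.N) * (U.C * ‖e‖) := by
  rw [norm_smul]
  calc _ ≤ ‖h x‖ * ((U.C * (1 + ‖x‖) ^ U.N) * ‖e‖) := by
        gcongr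
        refine (ContinuousLinearMap.le_opNorm _ _).trans ?_
        gcongr
        exact U.norm_le x
    _ = _ := by ring

end OperatorFamily

end OperatorFamily

section Averages

variable {V : Type*} [NormedAddCommGroup V] [InnerProductSpace ℝ V] [FiniteDimensional ℝ V]
  [MeasurableSpace V] [BorelSpace V]

theorem integrable_norm_mul_pow (h : 𝓢(V, ℂ)) (N : ℕ) :
    Integrable fun x => ‖h x‖ * (1 + ‖x‖) ^ N := by
  set r := Module.finrank ℝ V + 1
  set K := 2 ^ (N + r) * (Finset.Iic (N + r, 0)).sup (fun m => SchwartzMap.seminorm ℂ m.1 m.2) h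
  have hc : Continuous fun x => ‖h x‖ * (1 + ‖x‖) ^ N := by fun_prop
  refine Integrable.mono' ((integrable_one_add_norm_pow_inv (V := V)).const_mul K)
    hc.aestronglyMeasurable (Eventually.of_forall fun x => ?_)
  have h1 := SchwartzMap.one_add_le_sup_seminorm_apply (𝕜 := ℂ) (m := (N + r, 0)) (k := N + r)
    (n := 0) le_rfl le_rfl h x
  rw [norm_iteratedFDeriv_zero] at h1
  rw [Real.norm_of_nonneg (by positivity), ← div_eq_mul_inv, le_div_iff₀ (by positivity)]
  refine le_trans (le_of_eq ?_) h1
  rw [pow_add]; ring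

variable {E : Type*} [NormedAddCommGroup E] [NormedSpace ℂ E]

namespace OperatorFamily

variable (U : OperatorFamily V E)

theorem integrable_smul_apply (h : 𝓢(V, ℂ)) (e : E) : Integrable fun x => h x • U.op x e := by
  have hc : Continuous fun x => h x • U.op x e := h.continuous.smul (U.continuous_apply e)
  exact Integrable.mono' ((integrable_norm_mul_pow h U.N).mul_const _) hc.aestronglyMeasurable
    (Eventually.of_forall (U.norm_smul_apply_le h e))

/-- The average `∫ h(x) U_x dx` of a family of operators. -/
def average (h : 𝓢(V, ℂ)) : E →L[ℂ] E :=
  LinearMap.mkContinuous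
    { toFun := fun e => ∫ x, h x • U.op x e
      map_add' := fun e e' => by
        rw [← integral_add (U.integrable_smul_apply h e) (U.integrable_smul_apply h e')]
        simp
      map_smul' := fun c e => by
        rw [RingHom.id_apply, ← integral_smul]
        simp [smul_comm c] }
    ((∫ x, ‖h x‖ * (1 + ‖x‖) ^ U.N) * U.C) fun e => by
      rw [mul_assoc, ← integral_mul_const]
      exact norm_integral_le_of_norm_le ((integrable_norm_mul_pow h U.N).mul_const _)
        (Eventually.of_forall (U.norm_smul_apply_le h e))

theorem average_apply (h : 𝓢(V, ℂ)) (e : E) : U.average h e = ∫ x, h x • U.op x e := rfl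

/-- The witness is `s^d h(s ·)`, with `d` the dimension. Only the change of variables is kept: it
puts the dilation into `f`, so that limits in `s` are taken against a fixed `h`. -/
theorem exists_dilate (h : 𝓢(V, ℂ)) {s : ℝ} (hs : 0 < s) : ∃ h' : 𝓢(V, ℂ), ∀ f : V → E,
    ∫ x, h' x • f x = ∫ x, h x • f (s⁻¹ • x) := by
  let L : V ≃L[ℝ] V := ContinuousLinearEquiv.smulLeft (Units.mk0 s hs.ne')
  refine ⟨((s ^ Module.finrank ℝ V : ℝ) : ℂ) •
    SchwartzMap.compCLMOfContinuousLinearEquiv ℂ L h, fun f => ?_⟩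
  have h1 := Measure.integral_comp_smul_of_nonneg (μ := (volume : Measure V))
    (fun x => h x • f (s⁻¹ • x)) s (hR := hs.le)
  have h2 : ∀ x, (((s ^ Module.finrank ℝ V : ℝ) : ℂ) •
      SchwartzMap.compCLMOfContinuousLinearEquiv ℂ L h) x • f x =
      (s ^ Module.finrank ℝ V) • (h (s • x) • f (s⁻¹ • s • x)) := fun x => by
    rw [inv_smul_smul₀ hs.ne']
    change ((((s ^ Module.finrank ℝ V : ℝ) : ℂ)) * h (s • x)) • f x = _
    rw [mul_smul]
    exact Complex.coe_smul _ _
  simp_rw [h2]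
  rw [integral_smul, h1, smul_inv_smul₀ (by positivity)]

/-- Averages against dilates of a function of integral one form an approximate identity. -/
theorem exists_average_tendsto [CompleteSpace E] (hU : U.op 0 = ContinuousLinearMap.id ℂ E) :
    ∃ (h : ℕ → 𝓢(V, ℂ)) (K : ℝ), (∀ m, ‖U.average (h m)‖ ≤ K) ∧
      ∀ e, Tendsto (fun m => U.average (h m) e) atTop (𝓝 e) := by
  obtain ⟨h, hh⟩ := exists_schwartz_integral_eq_one (V := V)
  choose k hk using fun m : ℕ => exists_dilate (E := E) h (s := m + 1) (by positivity)
  -- Since `(m + 1)⁻¹ ≤ 1`, one integrable majorant serves every `m`; it gives both the uniform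
  -- bound and dominated convergence.
  have hbound : ∀ (m : ℕ) (e : E) (x : V), ‖h x • U.op (((m : ℝ) + 1)⁻¹ • x) e‖ ≤
      (‖h x‖ * (1 + ‖x‖) ^ U.N) * (U.C * ‖e‖) := fun m e x => by
    have hC := U.C_nonneg
    have hx : ‖((m : ℝ) + 1)⁻¹ • x‖ ≤ ‖x‖ := by
      rw [norm_smul, Real.norm_of_nonneg (by positivity)]
      exact mul_le_of_le_one_left (norm_nonneg x) (inv_le_one_of_one_le₀ (by simp))
    rw [norm_smul]
    calc _ ≤ ‖h x‖ * ((U.C * (1 + ‖x‖) ^ U.N) * ‖e‖) := by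
          gcongr
          refine (ContinuousLinearMap.le_opNorm _ _).trans ?_
          gcongr
          refine (U.norm_le _).trans ?_
          gcongr
      _ = _ := by ring
  have hfi : ∀ e : E, Integrable fun x => (‖h x‖ * (1 + ‖x‖) ^ U.N) * (U.C * ‖e‖) := fun e =>
    (integrable_norm_mul_pow h U.N).mul_const _
  refine ⟨k, (∫ x, ‖h x‖ * (1 + ‖x‖) ^ U.N) * U.C, fun m => ?_, fun e => ?_⟩
  · refine ContinuousLinearMap.opNorm_le_bound _ ?_ fun e => ?_
    · exact mul_nonneg (integral_nonneg fun x => by positivity) U.C_nonneg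
    · rw [average_apply, hk, mul_assoc, ← integral_mul_const]
      exact norm_integral_le_of_norm_le (hfi e) (Eventually.of_forall (hbound m e))
  · simp_rw [average_apply, hk]
    have he : e = ∫ x, h x • e := by rw [integral_smul_const, hh, one_smul]
    nth_rw 2 [he]
    refine tendsto_integral_of_dominated_convergence _ (fun m => ?_) (hfi e)
      (fun m => Eventually.of_forall (hbound m e)) (Eventually.of_forall fun x => ?_)
    · have : Continuous fun x => h x • U.op (((m : ℝ) + 1)⁻¹ • x) e :=
        h.continuous.smul ((U.continuous_apply e).comp (continuous_const_smul _))
      exact this.aestronglyMeasurable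
    · have h1 : Tendsto (fun m : ℕ => ((m : ℝ) + 1)⁻¹ • x) atTop (𝓝 0) := by
        have := (tendsto_one_div_add_atTop_nhds_zero_nat (𝕜 := ℝ)).smul_const x
        simpa using this
      have h2 := ((U.continuous_apply e).tendsto 0).comp h1
      rw [hU] at h2
      exact h2.const_smul (h x)

end OperatorFamily

end Averages

/-! ### Convolution and multiplication as averages of translations and modulations. -/

section Convolution

variable {V : Type*} [NormedAddCommGroup V] [InnerProductSpace ℝ V] [FiniteDimensional ℝ V]
  [MeasurableSpace V] [BorelSpace V]

/-- The convolution of two Schwartz functions. -/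
def schwartzConv (φ ψ : 𝓢(V, ℂ)) : 𝓢(V, ℂ) := 𝓕⁻ (schwartzMul (𝓕 φ) (𝓕 ψ))

theorem schwartzConv_comm (φ ψ : 𝓢(V, ℂ)) : schwartzConv φ ψ = schwartzConv ψ φ := by
  unfold schwartzConv
  congr 1
  ext t
  simp [mul_comm]

theorem fourierInv_schwartzModulate_neg (x : V) (φ : 𝓢(V, ℂ)) :
    𝓕⁻ (schwartzModulate (-x) φ) = schwartzTranslate x (𝓕⁻ φ) := by
  ext η
  rw [schwartzTranslate_apply, fourierInv_eq_integral_character, fourierInv_eq_integral_character]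
  simp only [schwartzModulate_apply, ← mul_assoc, character_mul_character, sub_eq_add_neg]

theorem integral_translate_mul (x : V) (χ θ : 𝓢(V, ℂ)) :
    ∫ t, schwartzTranslate x χ t * θ t = 𝓕 (schwartzMul (𝓕 χ) (𝓕⁻ θ)) x := by
  have h : schwartzTranslate x χ = 𝓕⁻ (schwartzModulate (-x) (𝓕 χ)) := by
    rw [fourierInv_schwartzModulate_neg, FourierTransform.fourierInv_fourier_eq]
  rw [h, SchwartzMap.integral_fourierInv_mul_eq, fourier_eq_integral_character]
  simp [mul_assoc]

theorem integral_mul_integral_translate (φ χ θ : 𝓢(V, ℂ)) :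
    ∫ x, φ x * ∫ t, schwartzTranslate x χ t * θ t = ∫ t, schwartzConv φ χ t * θ t := by
  simp_rw [integral_translate_mul]
  rw [← SchwartzMap.integral_fourier_mul_eq, schwartzConv, SchwartzMap.integral_fourierInv_mul_eq]
  simp [mul_assoc]

/-- The double Fourier transform of `φ` is its reflection. Writing the value at `y` as a pairing
with a test function is what lets it extend from `χ` to a bounded form on `E`. -/
theorem schwartzConv_apply (φ χ : 𝓢(V, ℂ)) (y : V) :
    schwartzConv φ χ y = ∫ t, χ t * schwartzTranslate y (𝓕 (𝓕 φ)) t := by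
  rw [← fourier_schwartzModulate, ← SchwartzMap.integral_fourier_mul_eq, schwartzConv,
    fourierInv_eq_integral_character]
  refine integral_congr_ae (Eventually.of_forall fun t => ?_)
  simp only [schwartzMul_apply, schwartzModulate_apply]
  ring

theorem integral_mul_integral_modulate (h χ θ : 𝓢(V, ℂ)) :
    ∫ ξ, h ξ * ∫ t, schwartzModulate (-ξ) χ t * θ t = ∫ t, schwartzMul (𝓕 h) χ t * θ t := by
  have h1 : ∀ ξ, ∫ t, schwartzModulate (-ξ) χ t * θ t = 𝓕 (schwartzMul χ θ) ξ := fun ξ => by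
    rw [fourier_eq_integral_character]
    simp [mul_assoc]
  simp_rw [h1]
  rw [← SchwartzMap.integral_fourier_mul_eq]
  simp [mul_assoc]

end Convolution

/-- The quotient map by `W` is continuous, commutes with the integral and kills the integrand. -/
theorem integral_mem_of_isClosed {α X : Type*} [MeasurableSpace α] {μ : Measure α}
    [NormedAddCommGroup X] [NormedSpace ℂ X] [CompleteSpace X] {W : Submodule ℂ X}
    (hW : IsClosed (W : Set X)) {f : α → X} (hf : Integrable f μ) (hfW : ∀ a, f a ∈ W) :
    ∫ a, f a ∂μ ∈ W := by
  have : IsClosed (W : Set X) := hW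
  rw [← Submodule.ker_mkQ W, LinearMap.mem_ker, ← Submodule.mkQL_apply,
    ← W.mkQL.integral_comp_comm hf]
  have h0 : ∀ a, W.mkQL (f a) = 0 := fun a => by
    rw [Submodule.mkQL_apply, ← LinearMap.mem_ker, Submodule.ker_mkQ]; exact hfW a
  simp [h0]

/-! ### Finite rank approximation of the identity. -/

section Approximation

variable {ι : Type*} [Fintype ι] {E : Type*} [NormedAddCommGroup E] [NormedSpace ℂ E]

namespace Realization

variable {J : E →L[ℂ] 𝓢'(EuclideanSpace ℝ ι, ℂ)} (R : Realization J)

/-- The translations as a family of operators. -/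
def translations : OperatorFamily (EuclideanSpace ℝ ι) E :=
  ⟨R.T, R.C, R.N, R.norm_T_le, R.continuous_T⟩

/-- The modulations `M_{-ξ}` as a family of operators. -/
def modulations : OperatorFamily (EuclideanSpace ℝ ι) E :=
  ⟨fun ξ => R.M (-ξ), R.C, R.N, fun ξ => by simpa using R.norm_M_le (-ξ),
    fun e => (R.continuous_M e).comp continuous_neg⟩

theorem apply_average (R : Realization J) [CompleteSpace E]
    (U : OperatorFamily (EuclideanSpace ℝ ι) E)
    (h : 𝓢(EuclideanSpace ℝ ι, ℂ)) (e : E) (θ : 𝓢(EuclideanSpace ℝ ι, ℂ)) :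
    J (U.average h e) θ = ∫ x, h x * J (U.op x e) θ := by
  rw [← R.ev_apply, U.average_apply, ← ContinuousLinearMap.integral_comp_comm _
    (U.integrable_smul_apply h e)]
  simp [R.ev_apply]

theorem average_translations_incl (φ χ : 𝓢(EuclideanSpace ℝ ι, ℂ)) :
    R.translations.average φ (R.incl χ) = R.incl (schwartzConv φ χ) := by
  have := R.complete
  refine R.injective (DFunLike.ext _ _ fun θ => ?_)
  rw [R.apply_average, R.apply_incl_apply, ← integral_mul_integral_translate]
  simp_rw [← R.apply_incl_apply, ← R.T_incl]
  rfl

theorem average_modulations_incl (h χ : 𝓢(EuclideanSpace ℝ ι, ℂ)) :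
    R.modulations.average h (R.incl χ) = R.incl (schwartzMul (𝓕 h) χ) := by
  have := R.complete
  refine R.injective (DFunLike.ext _ _ fun θ => ?_)
  rw [R.apply_average, R.apply_incl_apply, ← integral_mul_integral_modulate]
  simp_rw [← R.apply_incl_apply, ← R.M_incl]
  rfl

/-- The finite rank operators spanned by `e' ↦ ⟨e', φ⟩ e` for test functions `φ`. -/
def testOperators : Submodule ℂ (E →L[ℂ] E) :=
  Submodule.span ℂ (Set.range fun p : 𝓢(EuclideanSpace ℝ ι, ℂ) × E => (R.ev p.1).smulRight p.2)

theorem norm_ev_translate_le (θ : 𝓢(EuclideanSpace ℝ ι, ℂ)) (y : EuclideanSpace ℝ ι) :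
    ‖R.ev (schwartzTranslate y θ)‖ ≤ ‖R.ev θ‖ * R.C ^ 2 * (1 + ‖y‖) ^ R.N := by
  have h := R.norm_ev_shift_le θ (y, 0)
  have h0 : ∀ φ : 𝓢(EuclideanSpace ℝ ι, ℂ), schwartzModulate 0 φ = φ := fun φ => by
    ext t; simp [character]
  simpa [h0, phaseWeight] using h

/-- On a Schwartz function `χ` the composite is `ρ * (ĥ · (φ * χ)) = ∫ ĥ(y) (φ * χ)(y) T_y ρ dy`,
and `(φ * χ)(y)` is a bounded linear form in `χ`. The factor `ĥ` makes this superposition of rank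
one operators converge in operator norm. -/
theorem average_comp_mem_closure (ρ h φ : 𝓢(EuclideanSpace ℝ ι, ℂ)) :
    R.translations.average ρ ∘L R.modulations.average h ∘L R.translations.average φ ∈
      R.testOperators.topologicalClosure := by
  have := R.complete
  set ψ := 𝓕 h
  set θ := 𝓕 (𝓕 φ)
  set f : EuclideanSpace ℝ ι → E →L[ℂ] E := fun y =>
    ψ y • (R.ev (schwartzTranslate y θ)).smulRight (R.T y (R.incl ρ)) with hf
  have hcont : Continuous f := by
    have h1 : Continuous fun y => R.ev (schwartzTranslate y θ) :=
      R.ev.continuous.comp (continuous_schwartzTranslate_const θ)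
    have h2 := R.continuous_T (R.incl ρ)
    have h3 : Continuous fun y => (ContinuousLinearMap.smulRightL ℂ E E
        (R.ev (schwartzTranslate y θ))) (R.T y (R.incl ρ)) := by fun_prop
    exact ψ.continuous.smul h3
  have hfi : Integrable f := by
    -- One power `R.N` comes from the translated evaluation form and one from `T_y`; the decay of
    -- `ψ` absorbs both.
    refine Integrable.mono' ((integrable_norm_mul_pow ψ (R.N + R.N)).mul_const
      ((‖R.ev θ‖ * R.C ^ 2) * (R.C * ‖R.incl ρ‖))) hcont.aestronglyMeasurable
      (Eventually.of_forall fun y => ?_)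
    have hC := R.C_nonneg
    rw [hf, norm_smul, ContinuousLinearMap.norm_smulRight_apply]
    calc _ ≤ ‖ψ y‖ * ((‖R.ev θ‖ * R.C ^ 2 * (1 + ‖y‖) ^ R.N) *
          ((R.C * (1 + ‖y‖) ^ R.N) * ‖R.incl ρ‖)) := by
          gcongr
          · exact R.norm_ev_translate_le θ y
          · refine (ContinuousLinearMap.le_opNorm _ _).trans ?_
            gcongr
            exact R.norm_T_le y
      _ = _ := by rw [pow_add]; ring
  have hmem : ∫ y, f y ∈ R.testOperators.topologicalClosure := by
    refine integral_mem_of_isClosed R.testOperators.isClosed_topologicalClosure hfi fun y => ?_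
    exact R.testOperators.le_topologicalClosure (R.testOperators.smul_mem _
      (Submodule.subset_span ⟨(schwartzTranslate y θ, R.T y (R.incl ρ)), rfl⟩))
  convert hmem
  refine DFunLike.coe_injective (R.dense_incl.equalizer (ContinuousLinearMap.continuous _)
    (ContinuousLinearMap.continuous _) (funext fun χ => ?_))
  simp only [Function.comp_apply, ContinuousLinearMap.comp_apply]
  -- Commutativity of the convolution exchanges the roles: the outer operator becomes the average of
  -- the translates of `ρ` with density `ψ · (φ * χ)`.
  rw [R.average_translations_incl, R.average_modulations_incl, R.average_translations_incl,
    schwartzConv_comm, ← R.average_translations_incl, ContinuousLinearMap.integral_apply hfi,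
    OperatorFamily.average_apply]
  refine integral_congr_ae (Eventually.of_forall fun y => ?_)
  simp only [hf, smul_apply, ContinuousLinearMap.smulRight_apply,
    R.ev_apply, R.apply_incl_apply, schwartzMul_apply, mul_smul]
  rw [schwartzConv_apply]
  rfl

theorem exists_approximation : ∃ (S : ℕ → E →L[ℂ] E) (K : ℝ), (∀ m, S m ∈ R.testOperators) ∧
    (∀ m, ‖S m‖ ≤ K) ∧ ∀ e, Tendsto (fun m => S m e) atTop (𝓝 e) := by
  have := R.complete
  obtain ⟨φ, K, hK, hφ⟩ := R.translations.exists_average_tendsto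
    (by ext e; exact R.T_zero e)
  obtain ⟨h, K', hK', hh⟩ := R.modulations.exists_average_tendsto
    (by ext e; change R.M (-0) e = e; rw [neg_zero]; exact R.M_zero e)
  have hK0 : 0 ≤ K := (norm_nonneg _).trans (hK 0)
  have hK'0 : 0 ≤ K' := (norm_nonneg _).trans (hK' 0)
  set G : ℕ → E →L[ℂ] E := fun m => R.translations.average (φ m) ∘L
    R.modulations.average (h m) ∘L R.translations.average (φ m) with hG
  have hGK : ∀ m, ‖G m‖ ≤ K * (K' * K) := fun m => by
    refine (ContinuousLinearMap.opNorm_comp_le _ _).trans ?_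
    gcongr
    · exact hK m
    · refine (ContinuousLinearMap.opNorm_comp_le _ _).trans ?_
      gcongr
      · exact hK' m
      · exact hK m
  -- Boundedness lets strong convergence survive moving vectors, so the three factors of `G m` may
  -- tend to the identity simultaneously.
  have key : ∀ (A : ℕ → E →L[ℂ] E) (B : ℝ), (∀ m, ‖A m‖ ≤ B) →
      (∀ e, Tendsto (fun m => A m e) atTop (𝓝 e)) → ∀ (v : ℕ → E) (e : E),
      Tendsto v atTop (𝓝 e) → Tendsto (fun m => A m (v m)) atTop (𝓝 e) := by
    intro A B hB hA v e hv
    have h1 : Tendsto (fun m => A m (v m - e)) atTop (𝓝 0) := by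
      refine squeeze_zero_norm (a := fun m => B * ‖v m - e‖) (fun m => ?_) ?_
      · refine (ContinuousLinearMap.le_opNorm _ _).trans ?_
        gcongr
        exact hB m
      · simpa using (tendsto_iff_norm_sub_tendsto_zero.1 hv).const_mul B
    simpa using h1.add (hA e)
  have hGe : ∀ e, Tendsto (fun m => G m e) atTop (𝓝 e) := fun e =>
    key _ K hK hφ _ e (key _ K' hK' hh _ e (hφ e))
  -- Approximation in operator norm, not merely pointwise, preserves the uniform bound and so yields
  -- a single sequence instead of an iterated limit.
  have hex : ∀ m : ℕ, ∃ S ∈ R.testOperators, ‖G m - S‖ < 1 / ((m : ℝ) + 1) := fun m => by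
    have := Metric.mem_closure_iff.1 (R.average_comp_mem_closure (φ m) (h m) (φ m))
      (1 / ((m : ℝ) + 1)) (by positivity)
    simp only [dist_eq_norm] at this
    exact this
  choose S hS hGS using hex
  refine ⟨S, K * (K' * K) + 1, hS, fun m => ?_, fun e => ?_⟩
  · have h1 : ‖S m‖ ≤ ‖G m‖ + ‖G m - S m‖ := by
      have := norm_sub_le (G m) (G m - S m)
      rwa [sub_sub_cancel] at this
    have h2 : 1 / ((m : ℝ) + 1) ≤ 1 := by
      rw [div_le_one (by positivity)]; simp
    linarith [hGK m, hGS m]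
  · have h1 : Tendsto (fun m => (G m - S m) e) atTop (𝓝 0) := by
      refine squeeze_zero_norm (a := fun m : ℕ => 1 / ((m : ℝ) + 1) * ‖e‖) (fun m => ?_) ?_
      · refine (ContinuousLinearMap.le_opNorm _ _).trans ?_
        gcongr
        exact (hGS m).le
      · simpa using (tendsto_one_div_add_atTop_nhds_zero_nat (𝕜 := ℝ)).mul_const ‖e‖
    simpa using (hGe e).sub h1

end Realization

end Approximation

/-! ### From bounded pointwise convergence to uniform convergence on compact sets. -/

section CompactConvergence

variable {E : Type*} [NormedAddCommGroup E] [NormedSpace ℂ E]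

/-- A bounded sequence of operators that converges pointwise to the identity converges uniformly on
compact sets. -/
theorem tendsto_idOperator {S : ℕ → E →L[ℂ] E} {K : ℝ} (hK : ∀ m, ‖S m‖ ≤ K)
    (hS : ∀ e, Tendsto (fun m => S m e) atTop (𝓝 e)) :
    Tendsto (fun m => ContinuousLinearMap.toUniformConvergenceCLM (RingHom.id ℂ) E
      {Q : Set E | IsCompact Q} (S m)) atTop (𝓝 (idOperator E)) := by
  rw [UniformConvergenceCLM.tendsto_iff_tendstoUniformlyOn]
  intro Q hQ
  have hK0 : 0 ≤ K := (norm_nonneg _).trans (hK 0)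
  rw [Metric.tendstoUniformlyOn_iff]
  intro ε hε
  -- Chosen so that `(K + 1) * δ = ε / 2`: this bounds the displacement from a centre of the cover
  -- together with its image under `S m`.
  set δ := ε / (2 * (K + 1)) with hδ
  have hδ0 : 0 < δ := by positivity
  obtain ⟨t, -, htf, ht⟩ := hQ.finite_cover_balls hδ0
  have h1 : ∀ᶠ m in atTop, ∀ y ∈ t, dist (S m y) y < ε / 2 :=
    (Set.Finite.eventually_all htf).2 fun y _ => Metric.tendsto_nhds.1 (hS y) _ (by positivity)
  filter_upwards [h1] with m hm x hx
  obtain ⟨y, hy, hxy⟩ := Set.mem_iUnion₂.1 (ht hx)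
  have h2 := hm y hy
  rw [Metric.mem_ball, dist_eq_norm] at hxy
  change dist x (S m x) < ε
  rw [dist_eq_norm] at h2 ⊢
  have h3 : ‖S m (x - y)‖ ≤ K * ‖x - y‖ :=
    (ContinuousLinearMap.le_opNorm _ _).trans (by gcongr; exact hK m)
  calc ‖x - S m x‖ = ‖(x - y) - (S m y - y) - S m (x - y)‖ := by
        rw [map_sub]; congr 1; abel
    _ ≤ ‖x - y‖ + ‖S m y - y‖ + ‖S m (x - y)‖ :=
        (norm_sub_le _ _).trans (by gcongr; exact norm_sub_le _ _)
    _ < (K + 1) * δ + ε / 2 := by nlinarith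
    _ = ε := by rw [hδ]; field_simp; ring

theorem Realization.testOperators_le_range {ι : Type*} [Fintype ι]
    {J : E →L[ℂ] 𝓢'(EuclideanSpace ℝ ι, ℂ)} (R : Realization J) {A : E →L[ℂ] E}
    (hA : A ∈ R.testOperators) : ∃ s : (E →L[ℂ] ℂ) ⊗[ℂ] E, tensorToOperator E s =
      ContinuousLinearMap.toUniformConvergenceCLM (RingHom.id ℂ) E {Q : Set E | IsCompact Q} A := by
  induction hA using Submodule.span_induction with
  | mem A hA =>
    obtain ⟨p, rfl⟩ := hA
    exact ⟨R.ev p.1 ⊗ₜ p.2, rfl⟩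
  | zero => exact ⟨0, by simp⟩
  | add A B _ _ hA hB =>
    obtain ⟨s, hs⟩ := hA
    obtain ⟨t, ht⟩ := hB
    exact ⟨s + t, by simp [hs, ht]⟩
  | smul c A _ hA =>
    obtain ⟨s, hs⟩ := hA
    exact ⟨c • s, by simp [hs]⟩

theorem Realization.exists_tensor_approximation {ι : Type*} [Fintype ι]
    {J : E →L[ℂ] 𝓢'(EuclideanSpace ℝ ι, ℂ)} (R : Realization J) :
    ∃ s : ℕ → (E →L[ℂ] ℂ) ⊗[ℂ] E,
      Tendsto (fun m => tensorToOperator E (s m)) atTop (𝓝 (idOperator E)) := by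
  obtain ⟨S, K, hS, hK, hlim⟩ := R.exists_approximation
  choose s hs using fun m => R.testOperators_le_range (hS m)
  exact ⟨s, by simpa only [hs] using tendsto_idOperator hK hlim⟩

end CompactConvergence

/-! ### The universal property of the completed projective tensor product, and tensor products of
operators. -/

section ProjectiveTensor

theorem tendsto_apply_of_dense {Z : Type*} [NormedAddCommGroup Z] [NormedSpace ℂ Z]
    {P : ℕ → Z →L[ℂ] Z} {K : ℝ} (hb : ∀ m, ‖P m‖ ≤ K) {s : Set Z} (hs : Dense s)
    (hP : ∀ v ∈ s, Tendsto (fun m => P m v) atTop (𝓝 v)) (u : Z) :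
    Tendsto (fun m => P m u) atTop (𝓝 u) := by
  have hK0 : 0 ≤ K := (norm_nonneg _).trans (hb 0)
  refine Metric.tendsto_nhds.2 fun ε hε => ?_
  obtain ⟨v, huv, hv⟩ := Metric.dense_iff.1 hs u (ε / (2 * (K + 1)))
    (by positivity)
  filter_upwards [Metric.tendsto_nhds.1 (hP v hv) (ε / 2) (by positivity)] with m hm
  rw [Metric.mem_ball, dist_eq_norm] at huv
  rw [dist_eq_norm] at hm ⊢
  have h3 : ‖P m (v - u)‖ ≤ K * ‖v - u‖ :=
    (ContinuousLinearMap.le_opNorm _ _).trans (by gcongr; exact hb m)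
  have h4 : (K + 1) * ‖v - u‖ < (K + 1) * (ε / (2 * (K + 1))) := by gcongr
  have h5 : (K + 1) * (ε / (2 * (K + 1))) = ε / 2 := by field_simp
  calc ‖P m u - u‖ = ‖(P m v - v) + (v - u) - P m (v - u)‖ := by
        rw [map_sub]; congr 1; abel
    _ ≤ ‖P m v - v‖ + ‖v - u‖ + ‖P m (v - u)‖ :=
        (norm_sub_le _ _).trans (by gcongr; exact norm_add_le _ _)
    _ < ε := by linarith

variable {E F X : Type*} [NormedAddCommGroup E] [NormedSpace ℂ E] [NormedAddCommGroup F]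
  [NormedSpace ℂ F] [NormedAddCommGroup X] [NormedSpace ℂ X]

/-- The linear map on `E ⊗ F` induced by a bilinear map. -/
def ProjTensor.liftₗ (B : E →L[ℂ] F →L[ℂ] X) : ProjTensor E F →ₗ[ℂ] X :=
  (TensorProduct.lift B.toLinearMap₁₂ : E ⊗[ℂ] F →ₗ[ℂ] X)

theorem ProjTensor.liftₗ_tmul (B : E →L[ℂ] F →L[ℂ] X) (e : E) (f : F) :
    ProjTensor.liftₗ B (ProjTensor.tmul e f) = B e f :=
  TensorProduct.lift.tmul e f

/-- The estimate holds for the cost of every representation of `u`, hence for the infimum. -/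
theorem ProjTensor.norm_liftₗ_le (B : E →L[ℂ] F →L[ℂ] X) (u : ProjTensor E F) :
    ‖ProjTensor.liftₗ B u‖ ≤ ‖B‖ * ‖u‖ := by
  rw [ProjTensor.norm_def, Real.mul_iInf_of_nonneg (norm_nonneg B)]
  refine le_ciInf ?_
  rintro ⟨l, rfl⟩
  induction l with
  | nil => simp [ProjTensor.ofList, ProjTensor.cost]
  | cons p l ih =>
    have h1 : ProjTensor.ofList (p :: l) = ProjTensor.tmul p.1 p.2 + ProjTensor.ofList l := by
      simp [ProjTensor.ofList]
    have h2 : ProjTensor.cost (p :: l) = ‖p.1‖ * ‖p.2‖ + ProjTensor.cost l := by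
      simp [ProjTensor.cost]
    simp only at ih ⊢
    rw [h1, h2, map_add, ProjTensor.liftₗ_tmul, mul_add, ← mul_assoc]
    exact (norm_add_le _ _).trans (add_le_add (B.le_opNorm₂ p.1 p.2) ih)

theorem ProjTensor.norm_liftₗ_le_completion (B : E →L[ℂ] F →L[ℂ] X) (u : ProjTensor E F) :
    ‖ProjTensor.liftₗ B u‖ ≤ ‖B‖ * ‖(u : CompletedProjTensor E F)‖ :=
  (ProjTensor.norm_liftₗ_le B u).trans_eq
    (congrArg (‖B‖ * ·) (UniformSpace.Completion.norm_coe u).symm)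

theorem norm_ctmul_le (e : E) (f : F) : ‖ctmul e f‖ ≤ ‖e‖ * ‖f‖ := by
  refine (UniformSpace.Completion.norm_coe (ProjTensor.tmul e f)).le.trans ?_
  change @norm (ProjTensor E F) instNormProjTensor _ ≤ _
  simpa [ProjTensor.ofList, ProjTensor.cost] using ProjTensor.norm_ofList_le [(e, f)]

variable (E F) in
/-- The canonical bilinear map `E × F → E ⊗̂_π F`. -/
def ctmulL : E →L[ℂ] F →L[ℂ] CompletedProjTensor E F :=
  LinearMap.mkContinuous₂ (LinearMap.mk₂ ℂ ctmul
    (fun e e' f => by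
      rw [ctmul, ctmul, ctmul, ← UniformSpace.Completion.coe_add]
      exact congrArg _ (TensorProduct.add_tmul e e' f))
    (fun c e f => by
      rw [ctmul, ctmul, ← UniformSpace.Completion.coe_smul]
      exact congrArg _ (TensorProduct.smul_tmul' c e f).symm)
    (fun e f f' => by
      rw [ctmul, ctmul, ctmul, ← UniformSpace.Completion.coe_add]
      exact congrArg _ (TensorProduct.tmul_add e f f'))
    (fun c e f => by
      rw [ctmul, ctmul, ← UniformSpace.Completion.coe_smul]
      exact congrArg _ (TensorProduct.tmul_smul c e f))) 1
    (fun e f => by rw [one_mul]; exact norm_ctmul_le e f)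

theorem ctmulL_apply (e : E) (f : F) : ctmulL E F e f = ctmul e f := rfl

theorem ctmul_mem_span_dense :
    Dense (Submodule.span ℂ (Set.range fun p : E × F => ctmul p.1 p.2) :
      Set (CompletedProjTensor E F)) := by
  refine (UniformSpace.Completion.denseRange_coe (α := ProjTensor E F)).mono ?_
  rintro _ ⟨u, rfl⟩
  obtain ⟨l, rfl⟩ := ProjTensor.exists_ofList u
  induction l with
  | nil => exact Submodule.zero_mem _
  | cons p l ih =>
    have h1 : ProjTensor.ofList (p :: l) = ProjTensor.tmul p.1 p.2 + ProjTensor.ofList l := by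
      simp [ProjTensor.ofList]
    rw [h1, UniformSpace.Completion.coe_add]
    exact Submodule.add_mem _ (Submodule.subset_span ⟨p, rfl⟩) ih

/-- Continuous linear maps on `E ⊗̂_π F` are determined by their values on elementary tensors. -/
theorem eq_of_forall_ctmul {Y : Type*} [AddCommGroup Y] [Module ℂ Y] [TopologicalSpace Y]
    [T2Space Y] {A B : CompletedProjTensor E F →L[ℂ] Y}
    (h : ∀ e f, A (ctmul e f) = B (ctmul e f)) : A = B :=
  ContinuousLinearMap.ext_on ctmul_mem_span_dense (by rintro _ ⟨p, rfl⟩; exact h p.1 p.2)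

variable [CompleteSpace X]

/-- The continuous linear map on `E ⊗̂_π F` induced by a bounded bilinear map. -/
def projLift (B : E →L[ℂ] F →L[ℂ] X) : CompletedProjTensor E F →L[ℂ] X :=
  LinearMap.extendOfNorm (ProjTensor.liftₗ B)
    (UniformSpace.Completion.toComplL (𝕜 := ℂ) (E := ProjTensor E F)).toLinearMap

theorem projLift_ctmul (B : E →L[ℂ] F →L[ℂ] X) (e : E) (f : F) :
    projLift B (ctmul e f) = B e f := by
  rw [← ProjTensor.liftₗ_tmul]
  exact LinearMap.extendOfNorm_eq UniformSpace.Completion.denseRange_coe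
    ⟨‖B‖, fun u => ProjTensor.norm_liftₗ_le_completion B u⟩ _

theorem norm_projLift_le (B : E →L[ℂ] F →L[ℂ] X) : ‖projLift B‖ ≤ ‖B‖ :=
  LinearMap.opNorm_extendOfNorm_le UniformSpace.Completion.denseRange_coe (norm_nonneg B)
    (ProjTensor.norm_liftₗ_le_completion B)

/-- Evaluation `B ↦ projLift B u` as a linear map. -/
def projLiftEvalₗ (u : CompletedProjTensor E F) : (E →L[ℂ] F →L[ℂ] X) →ₗ[ℂ] X where
  toFun B := projLift B u
  map_add' B B' := by
    have h : projLift (B + B') = projLift B + projLift B' :=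
      eq_of_forall_ctmul fun e f => by simp [projLift_ctmul]
    rw [h]; rfl
  map_smul' c B := by
    have h : projLift (c • B) = c • projLift B :=
      eq_of_forall_ctmul fun e f => by simp [projLift_ctmul]
    rw [h]; rfl

theorem norm_projLiftEvalₗ_le (u : CompletedProjTensor E F) (B : E →L[ℂ] F →L[ℂ] X) :
    ‖projLiftEvalₗ u B‖ ≤ ‖u‖ * ‖B‖ := by
  rw [mul_comm]
  exact ((projLift B).le_opNorm u).trans
    (mul_le_mul_of_nonneg_right (norm_projLift_le B) (norm_nonneg u))

/-- Evaluation `B ↦ projLift B u` as a continuous linear map. -/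
def projLiftEval (u : CompletedProjTensor E F) : (E →L[ℂ] F →L[ℂ] X) →L[ℂ] X where
  toLinearMap := projLiftEvalₗ u
  cont := AddMonoidHomClass.continuous_of_bound (projLiftEvalₗ (X := X) u) ‖u‖
    (norm_projLiftEvalₗ_le u)

/-- The tensor product `A ⊗ B` of two operators. -/
def projMap (A : E →L[ℂ] E) (B : F →L[ℂ] F) :
    CompletedProjTensor E F →L[ℂ] CompletedProjTensor E F :=
  projLift ((ctmulL E F).bilinearComp A B)

theorem projMap_ctmul (A : E →L[ℂ] E) (B : F →L[ℂ] F) (e : E) (f : F) :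
    projMap A B (ctmul e f) = ctmul (A e) (B f) := projLift_ctmul _ e f

theorem norm_projMap_le (A : E →L[ℂ] E) (B : F →L[ℂ] F) : ‖projMap A B‖ ≤ ‖A‖ * ‖B‖ := by
  refine (norm_projLift_le _).trans ?_
  refine ContinuousLinearMap.opNorm_le_bound₂ _ (by positivity) fun e f => ?_
  calc ‖ctmul (A e) (B f)‖ ≤ ‖A e‖ * ‖B f‖ := norm_ctmul_le _ _
    _ ≤ (‖A‖ * ‖e‖) * (‖B‖ * ‖f‖) := by gcongr <;> exact ContinuousLinearMap.le_opNorm _ _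
    _ = _ := by ring

/-- If `S_m → id` boundedly and pointwise, then `S_m ⊗ id → id` pointwise. -/
theorem tendsto_projMap_id {S : ℕ → E →L[ℂ] E} {K : ℝ} (hK : ∀ m, ‖S m‖ ≤ K)
    (hS : ∀ e, Tendsto (fun m => S m e) atTop (𝓝 e)) (u : CompletedProjTensor E F) :
    Tendsto (fun m => projMap (S m) (ContinuousLinearMap.id ℂ F) u) atTop (𝓝 u) := by
  have hK0 : 0 ≤ K := (norm_nonneg _).trans (hK 0)
  have hb : ∀ m, ‖projMap (S m) (ContinuousLinearMap.id ℂ F)‖ ≤ K := fun m => by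
    refine (norm_projMap_le _ _).trans ?_
    calc _ ≤ K * 1 := by
          gcongr
          · exact hK m
          · exact ContinuousLinearMap.norm_id_le
      _ = K := mul_one K
  have hspan : ∀ v ∈ Submodule.span ℂ (Set.range fun p : E × F => ctmul p.1 p.2),
      Tendsto (fun m => projMap (S m) (ContinuousLinearMap.id ℂ F) v) atTop (𝓝 v) := by
    intro v hv
    induction hv using Submodule.span_induction with
    | mem v hv =>
      obtain ⟨p, rfl⟩ := hv
      simp_rw [projMap_ctmul]
      exact (((ctmulL E F).flip p.2).continuous.tendsto p.1).comp (hS p.1)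
    | zero => simp
    | add v w _ _ hv hw => simpa using hv.add hw
    | smul c v _ hv => simpa using hv.const_smul c
  exact tendsto_apply_of_dense hb ctmul_mem_span_dense hspan u

end ProjectiveTensor

/-! ### Factorisation of integrals, characters and shifts over the two groups of variables. -/

section TensorIntegrals

variable {ι κ : Type*} [Fintype ι] [Fintype κ]

theorem measurePreserving_proj : MeasurePreserving
    (fun z : EuclideanSpace ℝ (ι ⊕ κ) => (projLeft z, projRight z)) := by
  have h1 := PiLp.volume_preserving_ofLp (ι ⊕ κ)
  have h2 := volume_measurePreserving_sumPiEquivProdPi (fun _ : ι ⊕ κ => ℝ)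
  have h3 := (PiLp.volume_preserving_toLp ι).prod (PiLp.volume_preserving_toLp κ)
  exact h3.comp (h2.comp h1)

theorem integral_proj_mul (f : EuclideanSpace ℝ ι → ℂ) (g : EuclideanSpace ℝ κ → ℂ)
    (hf : Continuous f) (hg : Continuous g) :
    ∫ z : EuclideanSpace ℝ (ι ⊕ κ), f (projLeft z) * g (projRight z) =
      (∫ x, f x) * ∫ y, g y := by
  have h := measurePreserving_proj (ι := ι) (κ := κ)
  rw [← integral_prod_mul, ← Measure.volume_eq_prod, ← h.map_eq, integral_map
    h.measurable.aemeasurable]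
  exact Continuous.aestronglyMeasurable (by fun_prop)

@[simp]
theorem schwartzTensor_apply (φ : 𝓢(EuclideanSpace ℝ ι, ℂ)) (ψ : 𝓢(EuclideanSpace ℝ κ, ℂ))
    (z : EuclideanSpace ℝ (ι ⊕ κ)) :
    schwartzTensor φ ψ z = φ (projLeft z) * ψ (projRight z) := rfl

theorem integral_schwartzTensor_mul (φ φ' : 𝓢(EuclideanSpace ℝ ι, ℂ))
    (ψ ψ' : 𝓢(EuclideanSpace ℝ κ, ℂ)) :
    ∫ z, schwartzTensor φ ψ z * schwartzTensor φ' ψ' z =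
      (∫ x, φ x * φ' x) * ∫ y, ψ y * ψ' y := by
  rw [← integral_proj_mul (fun x => φ x * φ' x) (fun y => ψ y * ψ' y) (by fun_prop) (by fun_prop)]
  refine integral_congr_ae (Eventually.of_forall fun z => ?_)
  simp only [schwartzTensor_apply]
  ring

theorem character_sum (ζ z : EuclideanSpace ℝ (ι ⊕ κ)) : character ζ z =
    character (projLeft ζ) (projLeft z) * character (projRight ζ) (projRight z) := by
  have h : ⟪ζ, z⟫_ℝ = ⟪projLeft ζ, projLeft z⟫_ℝ + ⟪projRight ζ, projRight z⟫_ℝ := by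
    simp [PiLp.inner_apply, projLeft_apply, projRight_apply]
  rw [character, character, character, ← Complex.exp_add, h]
  congr 1
  push_cast
  ring

theorem schwartzTranslate_schwartzTensor (x : EuclideanSpace ℝ (ι ⊕ κ))
    (φ : 𝓢(EuclideanSpace ℝ ι, ℂ)) (ψ : 𝓢(EuclideanSpace ℝ κ, ℂ)) :
    schwartzTranslate x (schwartzTensor φ ψ) =
      schwartzTensor (schwartzTranslate (projLeft x) φ) (schwartzTranslate (projRight x) ψ) := by
  ext z; simp

theorem schwartzModulate_schwartzTensor (ξ : EuclideanSpace ℝ (ι ⊕ κ))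
    (φ : 𝓢(EuclideanSpace ℝ ι, ℂ)) (ψ : 𝓢(EuclideanSpace ℝ κ, ℂ)) :
    schwartzModulate ξ (schwartzTensor φ ψ) =
      schwartzTensor (schwartzModulate (projLeft ξ) φ) (schwartzModulate (projRight ξ) ψ) := by
  ext z
  simp only [schwartzModulate_apply, schwartzTensor_apply, character_sum]
  ring

theorem norm_projLeft_le (z : EuclideanSpace ℝ (ι ⊕ κ)) : ‖projLeft z‖ ≤ ‖z‖ := by
  have h : ‖z‖ ^ 2 = ‖projLeft z‖ ^ 2 + ‖projRight z‖ ^ 2 := by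
    simp [EuclideanSpace.norm_sq_eq, projLeft_apply, projRight_apply]
  exact (sq_le_sq₀ (norm_nonneg _) (norm_nonneg _)).1 (by nlinarith [sq_nonneg ‖projRight z‖])

theorem norm_projRight_le (z : EuclideanSpace ℝ (ι ⊕ κ)) : ‖projRight z‖ ≤ ‖z‖ := by
  have h : ‖z‖ ^ 2 = ‖projLeft z‖ ^ 2 + ‖projRight z‖ ^ 2 := by
    simp [EuclideanSpace.norm_sq_eq, projLeft_apply, projRight_apply]
  exact (sq_le_sq₀ (norm_nonneg _) (norm_nonneg _)).1 (by nlinarith [sq_nonneg ‖projLeft z‖])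

/-- The left components of a phase space point. -/
def phaseLeft (p : EuclideanSpace ℝ (ι ⊕ κ) × EuclideanSpace ℝ (ι ⊕ κ)) :
    EuclideanSpace ℝ ι × EuclideanSpace ℝ ι := (projLeft p.1, projLeft p.2)

/-- The right components of a phase space point. -/
def phaseRight (p : EuclideanSpace ℝ (ι ⊕ κ) × EuclideanSpace ℝ (ι ⊕ κ)) :
    EuclideanSpace ℝ κ × EuclideanSpace ℝ κ := (projRight p.1, projRight p.2)

theorem continuous_phaseLeft : Continuous (phaseLeft (ι := ι) (κ := κ)) := by
  unfold phaseLeft; fun_prop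

theorem continuous_phaseRight : Continuous (phaseRight (ι := ι) (κ := κ)) := by
  unfold phaseRight; fun_prop

theorem phaseWeight_phaseLeft_le (p : EuclideanSpace ℝ (ι ⊕ κ) × EuclideanSpace ℝ (ι ⊕ κ)) :
    phaseWeight (phaseLeft p) ≤ phaseWeight p := by
  unfold phaseWeight phaseLeft
  gcongr <;> exact norm_projLeft_le _

theorem phaseWeight_phaseRight_le (p : EuclideanSpace ℝ (ι ⊕ κ) × EuclideanSpace ℝ (ι ⊕ κ)) :
    phaseWeight (phaseRight p) ≤ phaseWeight p := by
  unfold phaseWeight phaseRight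
  gcongr <;> exact norm_projRight_le _

end TensorIntegrals

/-! ### The projective tensor product of two TMIB spaces as a TMIB space. -/

section TensorRealization

variable {ι κ : Type*} [Fintype ι] [Fintype κ] {E F : Type*} [NormedAddCommGroup E]
  [NormedSpace ℂ E] [NormedAddCommGroup F] [NormedSpace ℂ F]

/-- Windows on the two factors, and an analysis window that is dual to their tensor product. -/
structure TensorWindow (ι κ : Type*) [Fintype ι] [Fintype κ] where
  /-- The window on the left factor. -/
  left : 𝓢(EuclideanSpace ℝ ι, ℂ)
  /-- The window on the right factor. -/
  right : 𝓢(EuclideanSpace ℝ κ, ℂ)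
  /-- The analysis window. -/
  dual : 𝓢(EuclideanSpace ℝ (ι ⊕ κ), ℂ)
  integral_eq : ∫ t, dual t * schwartzTensor left right t = 1

instance : Nonempty (TensorWindow ι κ) := by
  obtain ⟨h, hh⟩ := exists_schwartz_integral_eq_one (V := EuclideanSpace ℝ ι)
  obtain ⟨k, hk⟩ := exists_schwartz_integral_eq_one (V := EuclideanSpace ℝ κ)
  have h0 : schwartzTensor h k ≠ 0 := by
    intro h0
    have h1 := integral_proj_mul h k h.continuous k.continuous
    rw [hh, hk, mul_one] at h1
    have h2 : ∀ z : EuclideanSpace ℝ (ι ⊕ κ), h (projLeft z) * k (projRight z) = 0 := fun z => by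
      rw [← schwartzTensor_apply, h0]; rfl
    simp [h2] at h1
  obtain ⟨G, hG⟩ := exists_integral_mul_eq_one h0
  exact ⟨⟨h, k, G, hG⟩⟩

/-- The time-frequency shift of a Schwartz function. -/
def schwartzShift {V : Type*} [NormedAddCommGroup V] [InnerProductSpace ℝ V] (p : V × V)
    (φ : 𝓢(V, ℂ)) : 𝓢(V, ℂ) := schwartzModulate p.2 (schwartzTranslate p.1 φ)

theorem schwartzShift_schwartzTensor (p : EuclideanSpace ℝ (ι ⊕ κ) × EuclideanSpace ℝ (ι ⊕ κ))
    (φ : 𝓢(EuclideanSpace ℝ ι, ℂ)) (ψ : 𝓢(EuclideanSpace ℝ κ, ℂ)) :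
    schwartzShift p (schwartzTensor φ ψ) =
      schwartzTensor (schwartzShift (phaseLeft p) φ) (schwartzShift (phaseRight p) ψ) := by
  rw [schwartzShift, schwartzTranslate_schwartzTensor, schwartzModulate_schwartzTensor]
  rfl

theorem mul_phaseWeight_le {a b C D : ℝ} {N M : ℕ} (hC : 0 ≤ C) (hD : 0 ≤ D) (hb0 : 0 ≤ b)
    (p : EuclideanSpace ℝ (ι ⊕ κ) × EuclideanSpace ℝ (ι ⊕ κ))
    (ha : a ≤ C * phaseWeight (phaseLeft p) ^ N) (hb : b ≤ D * phaseWeight (phaseRight p) ^ M) :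
    a * b ≤ C * D * phaseWeight p ^ (N + M) := by
  have h1 := (phaseWeight_pos (phaseLeft p)).le
  have h2 := (phaseWeight_pos (phaseRight p)).le
  have h3 := (phaseWeight_pos p).le
  calc a * b ≤ (C * phaseWeight p ^ N) * (D * phaseWeight p ^ M) := by
        refine mul_le_mul (ha.trans ?_) (hb.trans ?_) hb0 (by positivity)
        · gcongr; exact phaseWeight_phaseLeft_le p
        · gcongr; exact phaseWeight_phaseRight_le p
    _ = _ := by rw [pow_add]; ring

namespace Realization

variable {J : E →L[ℂ] 𝓢'(EuclideanSpace ℝ ι, ℂ)} {K : F →L[ℂ] 𝓢'(EuclideanSpace ℝ κ, ℂ)}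
  (R : Realization J) (Q : Realization K) (w : TensorWindow ι κ)

/-- The bilinear form `(e, f) ↦ ⟨e, M_ζ T_z h⟩ ⟨f, M_ζ' T_z' k⟩`. -/
def atomForm (p : EuclideanSpace ℝ (ι ⊕ κ) × EuclideanSpace ℝ (ι ⊕ κ)) : E →L[ℂ] F →L[ℂ] ℂ :=
  ContinuousLinearMap.smulRightL ℂ E (F →L[ℂ] ℂ) (R.ev (schwartzShift (phaseLeft p) w.left))
    (Q.ev (schwartzShift (phaseRight p) w.right))

theorem atomForm_apply (p : EuclideanSpace ℝ (ι ⊕ κ) × EuclideanSpace ℝ (ι ⊕ κ)) (e : E) (f : F) :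
    R.atomForm Q w p e f = J e (schwartzShift (phaseLeft p) w.left) *
      K f (schwartzShift (phaseRight p) w.right) := rfl

theorem continuous_atomForm : Continuous (R.atomForm Q w) := by
  have h1 : Continuous fun p : EuclideanSpace ℝ (ι ⊕ κ) × EuclideanSpace ℝ (ι ⊕ κ) =>
      R.ev (schwartzShift (phaseLeft p) w.left) :=
    R.ev.continuous.comp ((continuous_schwartzShift w.left).comp continuous_phaseLeft)
  have h2 : Continuous fun p : EuclideanSpace ℝ (ι ⊕ κ) × EuclideanSpace ℝ (ι ⊕ κ) =>
      Q.ev (schwartzShift (phaseRight p) w.right) :=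
    Q.ev.continuous.comp ((continuous_schwartzShift w.right).comp continuous_phaseRight)
  exact ((ContinuousLinearMap.smulRightL ℂ E (F →L[ℂ] ℂ)).continuous.comp h1).clm_apply h2

theorem norm_atomForm_le (p : EuclideanSpace ℝ (ι ⊕ κ) × EuclideanSpace ℝ (ι ⊕ κ)) :
    ‖R.atomForm Q w p‖ ≤ (‖R.ev w.left‖ * R.C ^ 2) * (‖Q.ev w.right‖ * Q.C ^ 2) *
      phaseWeight p ^ (R.N + Q.N) := by
  refine (ContinuousLinearMap.norm_smulRight_apply _ _).le.trans ?_
  exact mul_phaseWeight_le (by positivity) (by positivity) (norm_nonneg _) p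
    (R.norm_ev_shift_le _ _) (Q.norm_ev_shift_le _ _)

/-- The bounded bilinear form `(e, f) ↦ ⟨e ⊗ f, Θ⟩`, as a function of `Θ`. -/
def tensorForm : 𝓢(EuclideanSpace ℝ (ι ⊕ κ), ℂ) →L[ℂ] E →L[ℂ] F →L[ℂ] ℂ :=
  synthesis w.dual (R.atomForm Q w) (R.continuous_atomForm Q w) _ _ (R.norm_atomForm_le Q w)

theorem tensorForm_apply (Θ : 𝓢(EuclideanSpace ℝ (ι ⊕ κ), ℂ)) (e : E) (f : F) :
    R.tensorForm Q w Θ e f = ∫ p, stft w.dual Θ p * R.atomForm Q w p e f := by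
  exact map_synthesis ((ContinuousLinearMap.apply ℂ ℂ f) ∘L
    (ContinuousLinearMap.apply ℂ (F →L[ℂ] ℂ) e)) w.dual (R.atomForm Q w)
    (R.continuous_atomForm Q w) _ _ (R.norm_atomForm_le Q w) Θ

/-- Shifts of `w.left ⊗ w.right` are tensor products of shifts, so the atoms pair with `φ ⊗ ψ` as in
the reproducing formula for that window. This also shows independence of the window on Schwartz
functions. -/
theorem tensorForm_incl (Θ : 𝓢(EuclideanSpace ℝ (ι ⊕ κ), ℂ)) (φ : 𝓢(EuclideanSpace ℝ ι, ℂ))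
    (ψ : 𝓢(EuclideanSpace ℝ κ, ℂ)) :
    R.tensorForm Q w Θ (R.incl φ) (Q.incl ψ) = ∫ z, schwartzTensor φ ψ z * Θ z := by
  rw [tensorForm_apply, ← integral_stft_mul w.dual (schwartzTensor w.left w.right) Θ
    (schwartzTensor φ ψ) w.integral_eq]
  refine integral_congr_ae (Eventually.of_forall fun p => ?_)
  simp only [atomForm_apply, apply_incl_apply]
  rw [← integral_schwartzTensor_mul, ← schwartzShift_schwartzTensor]
  rfl

theorem tensorForm_schwartzTensor (φ : 𝓢(EuclideanSpace ℝ ι, ℂ)) (ψ : 𝓢(EuclideanSpace ℝ κ, ℂ))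
    (e : E) (f : F) : R.tensorForm Q w (schwartzTensor φ ψ) e f = J e φ * K f ψ := by
  change _ = R.ev φ e * Q.ev ψ f
  refine R.dense_incl.induction_on (p := fun e => R.tensorForm Q w (schwartzTensor φ ψ) e f =
    R.ev φ e * Q.ev ψ f) e (isClosed_eq (by fun_prop) (by fun_prop)) fun χ => ?_
  refine Q.dense_incl.induction_on (p := fun f => R.tensorForm Q w (schwartzTensor φ ψ)
    (R.incl χ) f = R.ev φ (R.incl χ) * Q.ev ψ f) f
    (isClosed_eq (by fun_prop) (by fun_prop)) fun χ' => ?_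
  rw [tensorForm_incl, ev_apply, ev_apply, apply_incl_apply, apply_incl_apply,
    integral_schwartzTensor_mul]

/-- The map `E ⊗̂_π F → 𝓢'` that sends `e ⊗ f` to the tensor product of distributions. -/
def tensorMap : CompletedProjTensor E F →L[ℂ] 𝓢'(EuclideanSpace ℝ (ι ⊕ κ), ℂ) where
  toFun u := ContinuousLinearMap.toPointwiseConvergenceCLM ℂ (RingHom.id ℂ)
    𝓢(EuclideanSpace ℝ (ι ⊕ κ), ℂ) ℂ (projLiftEval u ∘L R.tensorForm Q w)
  map_add' u v := DFunLike.ext _ _ fun Θ => map_add (projLift (R.tensorForm Q w Θ)) u v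
  map_smul' c u := DFunLike.ext _ _ fun Θ => map_smul (projLift (R.tensorForm Q w Θ)) c u
  cont := PointwiseConvergenceCLM.continuous_of_continuous_eval fun Θ =>
    (projLift (R.tensorForm Q w Θ)).continuous

theorem tensorMap_apply (u : CompletedProjTensor E F) (Θ : 𝓢(EuclideanSpace ℝ (ι ⊕ κ), ℂ)) :
    R.tensorMap Q w u Θ = projLift (R.tensorForm Q w Θ) u := rfl

theorem tensorMap_ctmul (e : E) (f : F) (Θ : 𝓢(EuclideanSpace ℝ (ι ⊕ κ), ℂ)) :
    R.tensorMap Q w (ctmul e f) Θ = R.tensorForm Q w Θ e f := by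
  rw [tensorMap_apply, projLift_ctmul]

theorem isDistributionTensor_tensorMap (e : E) (f : F) :
    IsDistributionTensor (J e) (K f) (R.tensorMap Q w (ctmul e f)) := fun φ ψ => by
  rw [tensorMap_ctmul, tensorForm_schwartzTensor]

theorem tensorMap_incl (φ : 𝓢(EuclideanSpace ℝ ι, ℂ)) (ψ : 𝓢(EuclideanSpace ℝ κ, ℂ)) :
    R.tensorMap Q w (ctmul (R.incl φ) (Q.incl ψ)) =
      SchwartzMap.toTemperedDistributionCLM (EuclideanSpace ℝ (ι ⊕ κ)) ℂ volume
        (schwartzTensor φ ψ) := by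
  refine DFunLike.ext _ _ fun Θ => ?_
  rw [tensorMap_ctmul, tensorForm_incl, toTemperedDistributionCLM_apply_eq]

theorem eq_of_forall_ctmul_incl {Y : Type*} [AddCommGroup Y] [Module ℂ Y] [TopologicalSpace Y]
    [T2Space Y] {A B : CompletedProjTensor E F →L[ℂ] Y} (R : Realization J) (Q : Realization K)
    (h : ∀ φ ψ, A (ctmul (R.incl φ) (Q.incl ψ)) = B (ctmul (R.incl φ) (Q.incl ψ))) : A = B := by
  refine eq_of_forall_ctmul fun e f => ?_
  refine R.dense_incl.induction_on (p := fun e => A (ctmul e f) = B (ctmul e f)) e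
    (isClosed_eq (A.continuous.comp ((ctmulL E F).flip f).continuous)
      (B.continuous.comp ((ctmulL E F).flip f).continuous)) fun φ => ?_
  exact Q.dense_incl.induction_on (p := fun f => A (ctmul (R.incl φ) f) = B (ctmul (R.incl φ) f)) f
    (isClosed_eq (A.continuous.comp (ctmulL E F (R.incl φ)).continuous)
      (B.continuous.comp (ctmulL E F (R.incl φ)).continuous)) fun ψ => h φ ψ

theorem tensorMap_projMap_T (x : EuclideanSpace ℝ (ι ⊕ κ)) (u : CompletedProjTensor E F) :
    R.tensorMap Q w (projMap (R.T (projLeft x)) (Q.T (projRight x)) u) =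
      translate x (R.tensorMap Q w u) := by
  have h : R.tensorMap Q w ∘L projMap (R.T (projLeft x)) (Q.T (projRight x)) =
      translate x ∘L R.tensorMap Q w := eq_of_forall_ctmul_incl R Q fun φ ψ => by
    simp only [ContinuousLinearMap.comp_apply]
    rw [projMap_ctmul, R.T_incl, Q.T_incl, tensorMap_incl, tensorMap_incl,
      translate_toTemperedDistribution, schwartzTranslate_schwartzTensor]
  exact DFunLike.congr_fun h u

theorem tensorMap_projMap_M (ξ : EuclideanSpace ℝ (ι ⊕ κ)) (u : CompletedProjTensor E F) :
    R.tensorMap Q w (projMap (R.M (projLeft ξ)) (Q.M (projRight ξ)) u) =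
      modulate ξ (R.tensorMap Q w u) := by
  have h : R.tensorMap Q w ∘L projMap (R.M (projLeft ξ)) (Q.M (projRight ξ)) =
      modulate ξ ∘L R.tensorMap Q w := eq_of_forall_ctmul_incl R Q fun φ ψ => by
    simp only [ContinuousLinearMap.comp_apply]
    rw [projMap_ctmul, R.M_incl, Q.M_incl, tensorMap_incl, tensorMap_incl,
      modulate_toTemperedDistribution, schwartzModulate_schwartzTensor]
  exact DFunLike.congr_fun h u

/-- For a generator, `(⟨·, φ⟩ e) ⊗ id` factors through the slice `⟨·, φ⟩ ⊗ id` with values in `F`.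
The slice of `u` pairs with `ψ` to the value of the distribution of `u` at `φ ⊗ ψ`, so it vanishes
by injectivity of `K`. -/
theorem projMap_eq_zero_of_mem_testOperators {u : CompletedProjTensor E F}
    (hu : R.tensorMap Q w u = 0) {A : E →L[ℂ] E} (hA : A ∈ R.testOperators) :
    projMap A (ContinuousLinearMap.id ℂ F) u = 0 := by
  have := Q.complete
  induction hA using Submodule.span_induction with
  | mem A hA =>
    obtain ⟨⟨φ, e⟩, rfl⟩ := hA
    let slice : CompletedProjTensor E F →L[ℂ] F :=
      projLift ((R.ev φ).smulRight (ContinuousLinearMap.id ℂ F))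
    have h1 : ∀ ψ, Q.ev ψ (slice u) = R.tensorMap Q w u (schwartzTensor φ ψ) := fun ψ => by
      have h : Q.ev ψ ∘L slice = projLift (R.tensorForm Q w (schwartzTensor φ ψ)) :=
        eq_of_forall_ctmul fun e f => by
          simp only [ContinuousLinearMap.comp_apply, slice]
          rw [projLift_ctmul, projLift_ctmul, tensorForm_schwartzTensor]
          simp [ev_apply]
      exact DFunLike.congr_fun h u
    have h2 : slice u = 0 := by
      refine Q.injective (DFunLike.ext _ _ fun ψ => ?_)
      rw [← Q.ev_apply, h1, hu, map_zero]
      rfl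
    have h3 : projMap ((R.ev φ).smulRight e) (ContinuousLinearMap.id ℂ F) =
        ctmulL E F e ∘L slice := eq_of_forall_ctmul fun e' f => by
      simp only [ContinuousLinearMap.comp_apply, slice]
      rw [projMap_ctmul, projLift_ctmul, ← ctmulL_apply]
      simp
    simp only [h3, ContinuousLinearMap.comp_apply, h2, map_zero]
  | zero =>
    have h : projMap (0 : E →L[ℂ] E) (ContinuousLinearMap.id ℂ F) = 0 :=
      eq_of_forall_ctmul fun e f => by
        rw [projMap_ctmul, ← ctmulL_apply]; simp
    rw [h]; rfl
  | add A B _ _ hA hB =>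
    have h : projMap (A + B) (ContinuousLinearMap.id ℂ F) =
        projMap A (ContinuousLinearMap.id ℂ F) + projMap B (ContinuousLinearMap.id ℂ F) :=
      eq_of_forall_ctmul fun e f => by
        rw [add_apply, projMap_ctmul, projMap_ctmul, projMap_ctmul, ← ctmulL_apply]
        simp [ctmulL_apply]
    rw [h, add_apply, hA, hB, add_zero]
  | smul c A _ hA =>
    have h : projMap (c • A) (ContinuousLinearMap.id ℂ F) =
        c • projMap A (ContinuousLinearMap.id ℂ F) :=
      eq_of_forall_ctmul fun e f => by
        rw [smul_apply, projMap_ctmul, projMap_ctmul, ← ctmulL_apply]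
        simp [ctmulL_apply]
    rw [h, smul_apply, hA, smul_zero]

/-- The approximating operators tensored with the identity kill `u`, yet converge to `u`; this is
where the approximation property enters (c). -/
theorem tensorMap_injective : Function.Injective (R.tensorMap Q w) := by
  refine (injective_iff_map_eq_zero _).2 fun u hu => ?_
  obtain ⟨S, C, hS, hC, hlim⟩ := R.exists_approximation
  have h := tendsto_projMap_id hC hlim u
  simp only [R.projMap_eq_zero_of_mem_testOperators Q w hu (hS _)] at h
  exact tendsto_nhds_unique h tendsto_const_nhds |>.symm ▸ rfl

/-- The inclusion of `𝓢` into `E ⊗̂_π F`. -/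
def tensorIncl : 𝓢(EuclideanSpace ℝ (ι ⊕ κ), ℂ) →L[ℂ] CompletedProjTensor E F :=
  synthesis w.dual (fun p => ctmulL E F (R.incl (schwartzShift (phaseLeft p) w.left))
      (Q.incl (schwartzShift (phaseRight p) w.right)))
    (by
      have h1 := R.incl.continuous.comp
        ((continuous_schwartzShift w.left).comp (continuous_phaseLeft (ι := ι) (κ := κ)))
      have h2 := Q.incl.continuous.comp
        ((continuous_schwartzShift w.right).comp (continuous_phaseRight (ι := ι) (κ := κ)))
      exact ((ctmulL E F).continuous.comp h1).clm_apply h2)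
    ((‖R.incl w.left‖ * R.C ^ 2) * (‖Q.incl w.right‖ * Q.C ^ 2)) (R.N + Q.N)
    (fun p => (norm_ctmul_le _ _).trans (mul_phaseWeight_le (by positivity) (by positivity)
      (norm_nonneg _) p (R.norm_incl_shift_le _ _) (Q.norm_incl_shift_le _ _)))

/-- Continuous forms pass through the superposition; each atom is a tensor of Schwartz functions,
whose pairing with `Θ` is known, and the reproducing formula for `Φ` recovers `∫ Φ Θ`. -/
theorem tensorMap_tensorIncl (Φ : 𝓢(EuclideanSpace ℝ (ι ⊕ κ), ℂ)) :
    R.tensorMap Q w (R.tensorIncl Q w Φ) =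
      SchwartzMap.toTemperedDistributionCLM (EuclideanSpace ℝ (ι ⊕ κ)) ℂ volume Φ := by
  refine DFunLike.ext _ _ fun Θ => ?_
  rw [tensorMap_apply, toTemperedDistributionCLM_apply_eq]
  refine (map_synthesis (projLift (R.tensorForm Q w Θ)) w.dual _ _ _ _ _ Φ).trans ?_
  simp only [mul_comm (Φ _)]
  rw [← integral_stft_mul w.dual (schwartzTensor w.left w.right) Φ Θ w.integral_eq]
  refine integral_congr_ae (Eventually.of_forall fun p => ?_)
  simp only [ctmulL_apply, projLift_ctmul, tensorForm_incl, smul_eq_mul]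
  rw [← schwartzShift_schwartzTensor]
  simp only [mul_comm (Θ _)]
  rfl

/-- Both sides represent the same distribution, so injectivity replaces a computation of the
vector-valued integral. It puts enough elementary tensors in the range for density. -/
theorem tensorIncl_schwartzTensor (φ : 𝓢(EuclideanSpace ℝ ι, ℂ))
    (ψ : 𝓢(EuclideanSpace ℝ κ, ℂ)) :
    R.tensorIncl Q w (schwartzTensor φ ψ) = ctmul (R.incl φ) (Q.incl ψ) :=
  R.tensorMap_injective Q w (by rw [tensorMap_tensorIncl, tensorMap_incl])

theorem denseRange_tensorIncl : DenseRange (R.tensorIncl Q w) := by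
  let D := (LinearMap.range (R.tensorIncl Q w).toLinearMap).topologicalClosure
  have hmem : ∀ e f, ctmul e f ∈ D := fun e f => by
    have hD : IsClosed (D : Set (CompletedProjTensor E F)) :=
      Submodule.isClosed_topologicalClosure _
    refine R.dense_incl.induction_on (p := fun e => ctmul e f ∈ D) e
      (hD.preimage ((ctmulL E F).flip f).continuous) fun φ => ?_
    refine Q.dense_incl.induction_on (p := fun f => ctmul (R.incl φ) f ∈ D) f
      (hD.preimage (ctmulL E F (R.incl φ)).continuous) fun ψ => ?_
    exact Submodule.le_topologicalClosure _
      ⟨schwartzTensor φ ψ, R.tensorIncl_schwartzTensor Q w φ ψ⟩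
  have hle : Submodule.span ℂ (Set.range fun p : E × F => ctmul p.1 p.2) ≤ D :=
    Submodule.span_le.2 (by rintro _ ⟨p, rfl⟩; exact hmem p.1 p.2)
  exact dense_closure.1 (ctmul_mem_span_dense.mono hle)

theorem norm_projMap_le_of_le {A : E →L[ℂ] E} {B : F →L[ℂ] F} {x : EuclideanSpace ℝ (ι ⊕ κ)}
    (hA : ‖A‖ ≤ R.C * (1 + ‖projLeft x‖) ^ R.N) (hB : ‖B‖ ≤ Q.C * (1 + ‖projRight x‖) ^ Q.N)
    (u : CompletedProjTensor E F) :
    ‖projMap A B u‖ ≤ (R.C * Q.C + 1) * (1 + ‖x‖) ^ ((R.N + Q.N + 1 : ℕ) : ℝ) * ‖u‖ := by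
  have hR := R.C_nonneg
  have hQ := Q.C_nonneg
  have hx : 1 ≤ 1 + ‖x‖ := le_add_of_nonneg_right (norm_nonneg x)
  refine ((projMap A B).le_opNorm u).trans (mul_le_mul_of_nonneg_right ?_ (norm_nonneg u))
  rw [Real.rpow_natCast]
  calc ‖projMap A B‖ ≤ ‖A‖ * ‖B‖ := norm_projMap_le A B
    _ ≤ (R.C * (1 + ‖x‖) ^ R.N) * (Q.C * (1 + ‖x‖) ^ Q.N) := by
        refine mul_le_mul (hA.trans ?_) (hB.trans ?_) (norm_nonneg _) (by positivity)
        · gcongr; exact norm_projLeft_le x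
        · gcongr; exact norm_projRight_le x
    _ = R.C * Q.C * (1 + ‖x‖) ^ (R.N + Q.N) := by rw [pow_add]; ring
    -- The constant and the exponent are each raised by one because the growth condition requires
    -- both to be strictly positive.
    _ ≤ (R.C * Q.C + 1) * (1 + ‖x‖) ^ (R.N + Q.N + 1) := by
        refine mul_le_mul (by linarith) (pow_le_pow_right₀ hx (Nat.le_succ _)) (by positivity)
          (by positivity)

theorem isTMIB_tensorMap : IsTMIB (R.tensorMap Q w) where
  complete := inferInstance
  injective := R.tensorMap_injective Q w
  -- The range contains all Schwartz functions, which are already dense in `𝓢'`.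
  dense := denseRange_toTemperedDistributionCLM.mono <| by
    rintro _ ⟨Φ, rfl⟩
    exact ⟨_, R.tensorMap_tensorIncl Q w Φ⟩
  schwartz := ⟨R.tensorIncl Q w, R.tensorMap_tensorIncl Q w, R.denseRange_tensorIncl Q w⟩
  translate_mem x u := ⟨_, R.tensorMap_projMap_T Q w x u⟩
  modulate_mem ξ u := ⟨_, R.tensorMap_projMap_M Q w ξ u⟩
  growth := by
    have hR := R.C_nonneg
    have hQ := Q.C_nonneg
    refine ⟨(R.N + Q.N + 1 : ℕ), by positivity, R.C * Q.C + 1, by positivity,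
      fun x u u' h => ?_, fun ξ u u' h => ?_⟩
    · rw [← R.tensorMap_projMap_T Q w] at h
      rw [R.tensorMap_injective Q w h]
      exact R.norm_projMap_le_of_le Q (R.norm_T_le _) (Q.norm_T_le _) u
    · rw [← R.tensorMap_projMap_M Q w] at h
      rw [R.tensorMap_injective Q w h, ← norm_neg ξ]
      exact R.norm_projMap_le_of_le Q (R.norm_M_le _) (Q.norm_M_le _) u

end Realization

end TensorRealization

end TMIB

end

theorem mainTheorem9 (d : ℕ) {E : Type*} [NormedAddCommGroup E] [NormedSpace ℂ E]
    (J : E →L[ℂ] 𝓢'(EuclideanSpace ℝ (Fin d), ℂ)) (hE : TMIB.IsTMIB J) :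
    (∃ S : ℕ → ℕ → (E →L[ℂ] ℂ) ⊗[ℂ] E, ∃ G : ℕ → (E →L_c[ℂ] E),
      (∀ m, Tendsto (fun n => TMIB.tensorToOperator E (S n m)) atTop (𝓝 (G m))) ∧
      Tendsto G atTop (𝓝 (TMIB.idOperator E))) ∧
    TMIB.HasWeakSequentialApproximationProperty E ∧
    ∀ {F : Type*} [NormedAddCommGroup F] [NormedSpace ℂ F]
      (K : F →L[ℂ] 𝓢'(EuclideanSpace ℝ (Fin d), ℂ)), TMIB.IsTMIB K →
      ∃ L : TMIB.CompletedProjTensor E F →L[ℂ] 𝓢'(EuclideanSpace ℝ (Fin d ⊕ Fin d), ℂ),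
        (∀ (e : E) (f : F), TMIB.IsDistributionTensor (J e) (K f) (L (TMIB.ctmul e f))) ∧
        TMIB.IsTMIB L := by
  obtain ⟨R⟩ := hE.nonempty_realization
  obtain ⟨s, hs⟩ := R.exists_tensor_approximation
  -- The sequence of (b) also serves (a): the double sequence is constant in `n`, so each inner
  -- limit is already of finite rank.
  refine ⟨⟨fun _ m => s m, fun m => TMIB.tensorToOperator E (s m), fun m => tendsto_const_nhds, hs⟩,
    ⟨fun m => TMIB.tensorToOperator E (s m), fun m => ⟨s m, rfl⟩, hs⟩, fun {F} _ _ K hF => ?_⟩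
  obtain ⟨Q⟩ := hF.nonempty_realization
  obtain ⟨w⟩ := (inferInstance : Nonempty (TMIB.TensorWindow (Fin d) (Fin d)))
  exact ⟨R.tensorMap Q w, R.isDistributionTensor_tensorMap Q w, R.isTMIB_tensorMap Q w⟩
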